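/- **The double Burnside algebra.** Let $G$ be a finite group. A finite $(G,G)$-biset is a finite set with commuting left and right $G$-actions. For bisets $M,N$ let $M\times_G N$ be the set of orbits of $G$ on $M\times N$ under $g(m,n)=(mg^{-1},gn)$; it is a biset via $h\,[m,n]\,p=[hm,np]$. The double Burnside algebra $B_{\mathbf Q}(G,G)$ is the $\mathbf Q$-vector space freely generated by the isomorphism classes of finite $(G,G)$-bisets, modulo the relations $[M\sqcup N]=[M]+[N]$, with multiplication determined by $[M]\cdot[N]=[M\times_G N]$ and identity element $[G]$. For a subgroup $U\le G\times G$, the set $(G\times G)/U$ is a biset via $h\cdot x\cdot g=(h,g^{-1})x$. Let $G=S_3$, $B:=B_{\mathbf Q}(S_3,S_3)$, $a:=(1,2)$, $b:=(1,2,3)$, $V_0:=1$, $V_1:=\langle a\rangle$, $V_4:=\langle b\rangle$, $V_5:=S_3$, $\Delta(V):=\{(v,v):v\in V\}$, $U_6:=\langle (a,a),(1,b)\rangle$, $U_7:=\langle (a,a),(b,1)\rangle$, $U_8:=\langle (a,a),(b,1),(1,b)\rangle$. Put $H_{i,j}:=[(S_3\times S_3)/(V_i\times V_j)]$ for $i,j\in\{0,1,4,5\}$,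 $H_s:=[(S_3\times S_3)/U_s]$ for $s\in\{6,7,8\}$ and $H^\Delta_t:=[(S_3\times S_3)/\Delta(V_t)]$ for $t\in\{1,4,5\}$. Define the following elements of $B$: - $e := -\tfrac{1}{2}H_{0,0}+H_{1,0}+\tfrac{1}{2}H_{4,0}$ - $g := \tfrac{4}{3}H_{0,0}-2H_{1,0}-\tfrac{4}{3}H_{0,1}-H_{4,0}+2H_{1,1}+H_{4,1}$ - $h := -\tfrac{1}{12}H_{0,0}+\tfrac{1}{3}H_{0,1}+\tfrac{1}{4}H_{4,0}-\tfrac{1}{4}H_{0,4}+\tfrac{3}{4}H_{4,4}-H_{4,1}$ - $\varepsilon_2 := -H_{0,0}+H_{1,0}+H_{0,1}+H^\Delta_1-2H_{1,1}$ - $\varepsilon_3 := -\tfrac{1}{4}H_{0,0}+\tfrac{1}{4}H_{4,0}+\tfrac{1}{4}H_{0,4}+\tfrac{1}{2}H^\Delta_4-\tfrac{3}{4}H_{4,4}$ - $\varepsilon_4 := \tfrac{1}{2}H_{0,0}-H^\Delta_1-\tfrac{1}{2}H^\Delta_4+H^\Delta_5$ - $b_{e,g} := \tfrac{1}{2}H_{0,0}-H_{1,0}-\tfrac{1}{2}H_{0,1}-\tfrac{1}{2}H_{4,0}+H_{1,1}+\tfrac{1}{2}H_{4,1}$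 - $b_{e,h} := -\tfrac{1}{8}H_{0,0}+\tfrac{1}{4}H_{1,0}+\tfrac{1}{2}H_{0,1}+\tfrac{1}{8}H_{4,0}-\tfrac{3}{8}H_{0,4}-H_{1,1}-\tfrac{1}{2}H_{4,1}+\tfrac{3}{4}H_{1,4}+\tfrac{3}{8}H_{4,4}$ - $b_{g,e} := -\tfrac{4}{3}H_{0,0}+2H_{1,0}+H_{4,0}$ - $b_{g,h} := -\tfrac{1}{3}H_{0,0}+\tfrac{1}{2}H_{1,0}+\tfrac{4}{3}H_{0,1}+\tfrac{1}{4}H_{4,0}-H_{0,4}-2H_{1,1}-H_{4,1}+\tfrac{3}{2}H_{1,4}+\tfrac{3}{4}H_{4,4}$ - $b_{h,e} := -\tfrac{1}{3}H_{0,0}+H_{4,0}$ - $b_{h,g} := \tfrac{1}{3}H_{0,0}-\tfrac{1}{3}H_{0,1}-H_{4,0}+H_{4,1}$ - $b_{e,\varepsilon_4} := -\tfrac{1}{8}H_{0,0}+\tfrac{1}{4}H_{1,0}+\tfrac{1}{4}H_{0,1}+\tfrac{1}{8}H_{4,0}+\tfrac{1}{8}H_{0,4}-\tfrac{1}{2}H_{1,1}-\tfrac{1}{4}H_{0,5}-\tfrac{1}{4}H_{4,1}-\tfrac{1}{4}H_{1,4}-\tfrac{1}{8}H_{4,4}+\tfrac{1}{2}H_{1,5}+\tfrac{1}{4}H_{4,5}$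 - $b_{g,\varepsilon_4} := -\tfrac{1}{3}H_{0,0}+\tfrac{1}{2}H_{1,0}+\tfrac{2}{3}H_{0,1}+\tfrac{1}{4}H_{4,0}+\tfrac{1}{3}H_{0,4}-H_{1,1}-\tfrac{2}{3}H_{0,5}-\tfrac{1}{2}H_{4,1}-\tfrac{1}{2}H_{1,4}-\tfrac{1}{4}H_{4,4}+H_{1,5}+\tfrac{1}{2}H_{4,5}$ - $b_{h,\varepsilon_4} := -\tfrac{1}{12}H_{0,0}+\tfrac{1}{6}H_{0,1}+\tfrac{1}{4}H_{4,0}+\tfrac{1}{12}H_{0,4}-\tfrac{1}{6}H_{0,5}-\tfrac{1}{2}H_{4,1}-\tfrac{1}{4}H_{4,4}+\tfrac{1}{2}H_{4,5}$ - $b_{\varepsilon_2,\varepsilon_4} := -\tfrac{1}{2}H_{0,0}+\tfrac{1}{2}H_{1,0}+\tfrac{1}{2}H_{0,1}+\tfrac{1}{2}H^\Delta_1+\tfrac{1}{2}H_{0,4}-H_{1,1}-\tfrac{1}{2}H_{0,5}-\tfrac{1}{2}H_6-\tfrac{1}{2}H_{1,4}+H_{1,5}$ - $b_{\varepsilon_4,e}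 := \tfrac{1}{6}H_{0,0}-\tfrac{1}{3}H_{1,0}-\tfrac{1}{6}H_{4,0}+\tfrac{1}{3}H_{5,0}$ - $b_{\varepsilon_4,g} := -\tfrac{1}{6}H_{0,0}+\tfrac{1}{3}H_{1,0}+\tfrac{1}{6}H_{0,1}+\tfrac{1}{6}H_{4,0}-\tfrac{1}{3}H_{1,1}-\tfrac{1}{3}H_{5,0}-\tfrac{1}{6}H_{4,1}+\tfrac{1}{3}H_{5,1}$ - $b_{\varepsilon_4,h} := \tfrac{1}{24}H_{0,0}-\tfrac{1}{12}H_{1,0}-\tfrac{1}{6}H_{0,1}-\tfrac{1}{24}H_{4,0}+\tfrac{1}{8}H_{0,4}+\tfrac{1}{3}H_{1,1}+\tfrac{1}{12}H_{5,0}+\tfrac{1}{6}H_{4,1}-\tfrac{1}{4}H_{1,4}-\tfrac{1}{8}H_{4,4}-\tfrac{1}{3}H_{5,1}+\tfrac{1}{4}H_{5,4}$ - $b_{\varepsilon_4,\varepsilon_2} := -\tfrac{1}{2}H_{0,0}+\tfrac{1}{2}H_{1,0}+\tfrac{1}{2}H_{0,1}+\tfrac{1}{2}H^\Delta_1+\tfrac{1}{2}H_{4,0}-H_{1,1}-\tfrac{1}{2}H_{5,0}-\tfrac{1}{2}H_{4,1}-\tfrac{1}{2}H_7+H_{5,1}$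 - $b' := \tfrac{1}{24}H_{0,0}-\tfrac{1}{12}H_{1,0}-\tfrac{1}{12}H_{0,1}-\tfrac{1}{24}H_{4,0}-\tfrac{1}{24}H_{0,4}+\tfrac{1}{6}H_{1,1}+\tfrac{1}{12}H_{5,0}+\tfrac{1}{12}H_{0,5}+\tfrac{1}{12}H_{4,1}+\tfrac{1}{12}H_{1,4}+\tfrac{1}{24}H_{4,4}-\tfrac{1}{6}H_{1,5}-\tfrac{1}{6}H_{5,1}-\tfrac{1}{12}H_{4,5}-\tfrac{1}{12}H_{5,4}+\tfrac{1}{6}H_{5,5}$ - $b'' := \tfrac{1}{4}H_{0,0}-\tfrac{3}{4}H_{1,0}-\tfrac{3}{4}H_{0,1}+\tfrac{1}{4}H^\Delta_1-\tfrac{1}{4}H_{4,0}-\tfrac{1}{4}H_{0,4}+\tfrac{3}{2}H_{1,1}+\tfrac{3}{4}H_{5,0}+\tfrac{3}{4}H_{0,5}-\tfrac{1}{4}H_6+\tfrac{3}{4}H_{4,1}+\tfrac{3}{4}H_{1,4}-\tfrac{1}{4}H_7+\tfrac{1}{4}H_{4,4}-\tfrac{3}{2}H_{1,5}-\tfrac{3}{2}H_{5,1}-\tfrac{3}{4}H_{4,5}-\tfrac{3}{4}H_{5,4}+\tfrac{1}{4}H_8+\tfrac{3}{2}H_{5,5}$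 Put $\varepsilon_1:=e+g+h$. **The algebra $A$.** Let $\mathbf Q[\bar\eta,\bar\xi]:=\mathbf Q[\eta,\xi]/(\eta^2,\eta\xi,\xi^2)$, where $\bar\eta,\bar\xi$ are the residue classes of $\eta,\xi$; it has the $\mathbf Q$-basis $1,\bar\eta,\bar\xi$. Let $$A:=\bigoplus_{i,j\in\{1,2,3,4\}}A_{i,j}=\begin{bmatrix}\mathbf Q^{3\times 3}&0&0&\mathbf Q^{3\times 1}\\0&\mathbf Q&0&\mathbf Q\\0&0&\mathbf Q&0\\ \mathbf Q^{1\times 3}&\mathbf Q&0&\mathbf Q[\bar\eta,\bar\xi]\end{bmatrix},$$ with multiplication $[a_{i,j}]\cdot[a'_{s,t}]:=\bigl[\sum_{r=1}^4\alpha_{i,r,j}(a_{i,r},a'_{r,j})\bigr]_{i,j}$, where $\alpha_{i,j,k}:A_{i,j}\times A_{j,k}\to A_{i,k}$ are the following $\mathbf Q$-bilinear maps, with $p=x+y\bar\eta+z\bar\xi$ ($x,y,z\in\mathbf Q$) and $q$ denoting elements of $\mathbf Q[\bar\eta,\bar\xi]$: - $\alpha_{1,1,1}(X,Y)=XY$,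 $\alpha_{1,1,4}(X,u)=Xu$, $\alpha_{1,4,4}(u,p)=xu$; - $\alpha_{2,2,2}(u,v)=uv$, $\alpha_{2,2,4}(u,v)=uv$, $\alpha_{2,4,4}(u,p)=xu$, $\alpha_{3,3,3}(u,v)=uv$; - $\alpha_{4,1,1}(v,X)=vX$, $\alpha_{4,1,4}(v,u)=vu\,\bar\eta$, $\alpha_{4,2,2}(u,v)=uv$, $\alpha_{4,2,4}(u,v)=uv(\bar\xi-12\bar\eta)$; - $\alpha_{4,4,1}(p,v)=xv$, $\alpha_{4,4,2}(p,v)=xv$, $\alpha_{4,4,4}(p,q)=pq$; - all other $\alpha_{i,j,k}$ are zero. This is an associative $\mathbf Q$-algebra whose identity element has the identity elements of $\mathbf Q^{3\times3},\mathbf Q,\mathbf Q,\mathbf Q[\bar\eta,\bar\xi]$ on the diagonal and zeros elsewhere. **The maps $\gamma_{i,j}$.** Define $\mathbf Q$-linear maps $\gamma_{i,j}:A_{i,j}\to B$ by - $\gamma_{1,1}\bigl((r_{s,t})\bigr)=r_{1,1}e+r_{1,2}b_{e,g}+r_{1,3}b_{e,h}+r_{2,1}b_{g,e}+r_{2,2}g+r_{2,3}b_{g,h}+r_{3,1}b_{h,e}+r_{3,2}b_{h,g}+r_{3,3}h$;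 - $\gamma_{1,4}\bigl((u_1,u_2,u_3)^{\mathsf T}\bigr)=u_1b_{e,\varepsilon_4}+u_2b_{g,\varepsilon_4}+u_3b_{h,\varepsilon_4}$; - $\gamma_{2,2}(u)=u\varepsilon_2$, $\gamma_{2,4}(u)=u\,b_{\varepsilon_2,\varepsilon_4}$, $\gamma_{3,3}(u)=u\varepsilon_3$; - $\gamma_{4,1}\bigl((v_1,v_2,v_3)\bigr)=v_1b_{\varepsilon_4,e}+v_2b_{\varepsilon_4,g}+v_3b_{\varepsilon_4,h}$, $\gamma_{4,2}(u)=u\,b_{\varepsilon_4,\varepsilon_2}$; - $\gamma_{4,4}(x+y\bar\eta+z\bar\xi)=x\varepsilon_4+y\,b'+z\,b''$; - $\gamma_{i,j}=0$ if $A_{i,j}=0$. **Proposition.** For all $i,j$, the map $\gamma_{i,j}$ is a $\mathbf Q$-linear isomorphism from $A_{i,j}$ onto the Peirce component $\varepsilon_iB\varepsilon_j$. For all $i,j,k$ and all $x\in A_{i,j}$, $y\in A_{j,k}$ one has $\gamma_{i,k}(\alpha_{i,j,k}(x,y))=\gamma_{i,j}(x)\,\gamma_{j,k}(y)$. The map $$\gamma:A\to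 B_{\mathbf Q}(S_3,S_3),\qquad [a_{i,j}]\mapsto\sum_{i,j\in\{1,2,3,4\}}\gamma_{i,j}(a_{i,j})$$ is an isomorphism of $\mathbf Q$-algebras. -/

import Mathlib

noncomputable section

namespace DoubleBurnside

open MulOpposite

/-! ### Bisets -/

/-- A finite `(G, G)`-biset: a finite set with a left `G`-action and a right `G`-action
(an action of the opposite group `Gᵐᵒᵖ`) that commute with each other. -/
structure Biset (G : Type) [Group G] : Type 1 where
  carrier : Type
  [left : MulAction G carrier]
  [right : MulAction Gᵐᵒᵖ carrier]
  [comm : SMulCommClass G Gᵐᵒᵖ carrier]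
  [finite : Finite carrier]

namespace Biset

variable {G : Type} [Group G]

instance : CoeSort (Biset G) Type := ⟨Biset.carrier⟩

attribute [instance] Biset.left Biset.right Biset.comm Biset.finite

/-- Isomorphism of bisets: a bijection compatible with both actions. -/
def Iso (M N : Biset G) : Prop :=
  ∃ f : M ≃ N, (∀ (g : G) (x : M), f (g • x) = g • f x) ∧
    ∀ (g : G) (x : M), f (op g • x) = op g • f x

theorem Iso.refl (M : Biset G) : Iso M M :=
  ⟨Equiv.refl _, fun _ _ => rfl, fun _ _ => rfl⟩

theorem Iso.symm {M N : Biset G} : Iso M N → Iso N M := by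
  rintro ⟨f, hl, hr⟩
  refine ⟨f.symm, fun g x => ?_, fun g x => ?_⟩
  · rw [Equiv.symm_apply_eq, hl, Equiv.apply_symm_apply]
  · rw [Equiv.symm_apply_eq, hr, Equiv.apply_symm_apply]

theorem Iso.trans {M N L : Biset G} : Iso M N → Iso N L → Iso M L := by
  rintro ⟨f, hl, hr⟩ ⟨f', hl', hr'⟩
  exact ⟨f.trans f', fun g x => by simp [hl, hl'], fun g x => by simp [hr, hr']⟩

instance setoid (G : Type) [Group G] : Setoid (Biset G) :=
  ⟨Iso, Iso.refl, Iso.symm, Iso.trans⟩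

/-- The disjoint union of two bisets. -/
def sum (M N : Biset G) : Biset G where
  carrier := M ⊕ N

/-- The group `G` as a biset, by multiplication on both sides. -/
def regular (G : Type) [Group G] [Finite G] : Biset G where
  carrier := G

/-- The transitive biset `(G × G) / U`, with `h · x · g = (h, g⁻¹) x`. -/
def transitive [Finite G] (U : Subgroup (G × G)) : Biset G where
  carrier := (G × G) ⧸ U
  left :=
    { smul := fun h x => ((h, 1) : G × G) • x
      one_smul := fun x => one_smul (G × G) x
      mul_smul := fun h k x => by
        change ((h * k, 1) : G × G) • x = ((h, 1) : G × G) • ((k, 1) : G × G) • x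
        rw [smul_smul, Prod.mk_mul_mk, one_mul] }
  right :=
    { smul := fun g x => ((1, (unop g)⁻¹) : G × G) • x
      one_smul := fun x => by
        change ((1, (1 : G)⁻¹) : G × G) • x = x
        rw [inv_one]; exact one_smul (G × G) x
      mul_smul := fun g k x => by
        change ((1, (unop k * unop g)⁻¹) : G × G) • x
          = ((1, (unop g)⁻¹) : G × G) • ((1, (unop k)⁻¹) : G × G) • x
        rw [smul_smul, Prod.mk_mul_mk, one_mul, mul_inv_rev] }
  comm := by
    refine @SMulCommClass.mk _ _ _ (_) (_) fun h g x => ?_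
    change ((h, 1) : G × G) • ((1, (unop g)⁻¹) : G × G) • x
      = ((1, (unop g)⁻¹) : G × G) • ((h, 1) : G × G) • x
    simp [smul_smul]

/-- `(m, n)` and `(m', n')` are in the same orbit of the left `G`-action
`g (m, n) = (m g⁻¹, g n)` on `M × N`. -/
def tensorSetoid (M N : Biset G) : Setoid (M × N) where
  r p q := ∃ g : G, q = (op g⁻¹ • p.1, g • p.2)
  iseqv :=
    { refl := fun p => ⟨1, by simp⟩
      symm := by
        rintro p q ⟨g, rfl⟩
        exact ⟨g⁻¹, by simp⟩
      trans := by
        rintro p q r ⟨g, rfl⟩ ⟨h, rfl⟩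
        exact ⟨h * g, by simp [mul_smul]⟩ }

/-- The tensor product of bisets: the set of `G`-orbits on `M × N`, with
`h (m ⊗ n) p = (h m) ⊗ (n p)`. -/
def tensor (M N : Biset G) : Biset G where
  carrier := Quotient (tensorSetoid M N)
  left :=
    { smul := fun h => Quotient.map (fun p : M × N => (h • p.1, p.2)) (by
        rintro p q ⟨g, rfl⟩
        exact ⟨g, Prod.ext (smul_comm h (op g⁻¹) p.1) rfl⟩)
      one_smul := by
        rintro ⟨p⟩
        exact congrArg (Quotient.mk _) (by simp)
      mul_smul := by
        rintro g h ⟨p⟩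
        exact congrArg (Quotient.mk _) (by simp [mul_smul]) }
  right :=
    { smul := fun h => Quotient.map (fun p : M × N => (p.1, h • p.2)) (by
        rintro p q ⟨g, rfl⟩
        exact ⟨g, Prod.ext rfl (smul_comm g h p.2).symm⟩)
      one_smul := by
        rintro ⟨p⟩
        exact congrArg (Quotient.mk _) (by simp)
      mul_smul := by
        rintro g h ⟨p⟩
        exact congrArg (Quotient.mk _) (by simp [mul_smul]) }
  comm := by
    refine @SMulCommClass.mk _ _ _ (_) (_) ?_
    rintro g h ⟨p⟩
    rfl

/-- The element `m ⊗ n` of the tensor product. -/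
def tmul {M N : Biset G} (m : M) (n : N) : tensor M N :=
  Quotient.mk (tensorSetoid M N) (m, n)

theorem smul_tmul {M N : Biset G} (h : G) (m : M) (n : N) :
    h • tmul m n = tmul (h • m) n := rfl

theorem op_smul_tmul {M N : Biset G} (h : G) (m : M) (n : N) :
    op h • tmul m n = tmul m (op h • n) := rfl

theorem tmul_balanced {M N : Biset G} (g : G) (m : M) (n : N) :
    tmul (op g • m) n = tmul m (g • n) :=
  Quotient.sound ⟨g, by simp [smul_smul]⟩

theorem tensor_ind {M N : Biset G} {P : tensor M N → Prop}
    (h : ∀ m n, P (tmul m n)) (x : tensor M N) : P x := by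
  obtain ⟨⟨m, n⟩⟩ := x
  exact h m n

/-- A balanced map `M × N → X` factors over the tensor product. -/
def tensorLift {M N : Biset G} {X : Type} (f : M → N → X)
    (hf : ∀ (g : G) m n, f (op g • m) n = f m (g • n)) (x : tensor M N) : X :=
  Quotient.lift (fun p : M × N => f p.1 p.2) (by
    rintro p q ⟨g, rfl⟩
    change f p.1 p.2 = f (op g⁻¹ • p.1) (g • p.2)
    rw [hf, inv_smul_smul]) x

theorem Iso.tensor {M M' N N' : Biset G} :
    Iso M M' → Iso N N' → Iso (M.tensor N) (M'.tensor N') := by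
  rintro ⟨f, fl, fr⟩ ⟨k, kl, kr⟩
  have fl' : ∀ (g : G) x, f.symm (g • x) = g • f.symm x := fun g x => by
    rw [Equiv.symm_apply_eq, fl, Equiv.apply_symm_apply]
  have fr' : ∀ (g : G) x, f.symm (op g • x) = op g • f.symm x := fun g x => by
    rw [Equiv.symm_apply_eq, fr, Equiv.apply_symm_apply]
  have kl' : ∀ (g : G) x, k.symm (g • x) = g • k.symm x := fun g x => by
    rw [Equiv.symm_apply_eq, kl, Equiv.apply_symm_apply]
  refine ⟨⟨tensorLift (fun m n => tmul (f m) (k n)) ?_,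
    tensorLift (fun m n => tmul (f.symm m) (k.symm n)) ?_, ?_, ?_⟩, ?_, ?_⟩
  · intro g m n; rw [fr, kl, tmul_balanced]
  · intro g m n; rw [fr', kl', tmul_balanced]
  · exact tensor_ind fun m n => by
      change tmul (f.symm (f m)) (k.symm (k n)) = _
      simp
  · exact tensor_ind fun m n => by
      change tmul (f (f.symm m)) (k (k.symm n)) = _
      simp
  · exact fun g => tensor_ind fun m n => by
      change tmul (f (g • m)) (k n) = g • tmul (f m) (k n)
      rw [fl]; rfl
  · exact fun g => tensor_ind fun m n => by
      change tmul (f m) (k (op g • n)) = op g • tmul (f m) (k n)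
      rw [kr]; rfl

theorem tensor_assoc (M N L : Biset G) :
    Iso ((M.tensor N).tensor L) (M.tensor (N.tensor L)) := by
  refine ⟨⟨tensorLift (fun x l => tensorLift (fun m n => tmul m (tmul n l)) ?_ x) ?_,
    tensorLift (fun m y => tensorLift (fun n l => tmul (tmul m n) l) ?_ y) ?_, ?_, ?_⟩, ?_, ?_⟩
  · intro g m n; rw [tmul_balanced]; rfl
  · rintro g ⟨⟨m, n⟩⟩ l
    change tmul m (tmul (op g • n) l) = tmul m (tmul n (g • l))
    rw [tmul_balanced]
  · intro g n l
    rw [← tmul_balanced]; rfl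
  · rintro g m ⟨⟨n, l⟩⟩
    change tmul (tmul (op g • m) n) l = tmul (tmul m (g • n)) l
    rw [tmul_balanced]
  · rintro ⟨⟨⟨⟨m, n⟩⟩, l⟩⟩; rfl
  · rintro ⟨⟨m, ⟨⟨n, l⟩⟩⟩⟩; rfl
  · rintro g ⟨⟨⟨⟨m, n⟩⟩, l⟩⟩; rfl
  · rintro g ⟨⟨⟨⟨m, n⟩⟩, l⟩⟩; rfl

theorem regular_tensor [Finite G] (M : Biset G) : Iso ((regular G).tensor M) M := by
  refine ⟨⟨tensorLift (fun (g : G) m => g • m) ?_, fun m => tmul (1 : G) m, ?_, ?_⟩, ?_, ?_⟩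
  · intro g (h : G) m
    change (h * g) • m = h • g • m
    rw [mul_smul]
  · refine tensor_ind fun (g : G) m => ?_
    refine (tmul_balanced (M := regular G) g (1 : G) m).symm.trans ?_
    exact congrArg (fun x : G => tmul (M := regular G) x m) (one_mul g)
  · intro m; exact one_smul G m
  · intro g
    refine tensor_ind fun (h : G) m => ?_
    change (g * h) • m = g • h • m
    rw [mul_smul]
  · intro g
    refine tensor_ind fun (h : G) m => ?_
    change h • op g • m = op g • h • m
    rw [smul_comm]

theorem tensor_regular [Finite G] (M : Biset G) : Iso (M.tensor (regular G)) M := by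
  refine ⟨⟨tensorLift (fun m (g : G) => op g • m) ?_, fun m => tmul m (1 : G), ?_, ?_⟩, ?_, ?_⟩
  · intro g m (h : G)
    change op h • op g • m = op (g * h) • m
    rw [op_mul, mul_smul]
  · refine tensor_ind fun m (g : G) => ?_
    refine (tmul_balanced (N := regular G) g m (1 : G)).trans ?_
    exact congrArg (fun x : G => tmul (N := regular G) m x) (mul_one g)
  · intro m; exact one_smul Gᵐᵒᵖ m
  · intro g
    refine tensor_ind fun m (h : G) => ?_
    exact (smul_comm g (op h) m).symm
  · intro g
    refine tensor_ind fun m (h : G) => ?_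
    change op (h * g) • m = op g • op h • m
    rw [op_mul, mul_smul]

theorem sum_tensor (M N L : Biset G) :
    Iso ((M.sum N).tensor L) ((M.tensor L).sum (N.tensor L)) := by
  refine ⟨⟨tensorLift (fun (x : M ⊕ N) l => Sum.map (fun m => tmul m l) (fun n => tmul n l) x) ?_,
    fun y : M.tensor L ⊕ N.tensor L => Sum.elim
      (tensorLift (fun m l => tmul (M := M.sum N) (Sum.inl m : M ⊕ N) l) ?_)
      (tensorLift (fun n l => tmul (M := M.sum N) (Sum.inr n : M ⊕ N) l) ?_) y, ?_, ?_⟩, ?_, ?_⟩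
  · rintro g (m | n) l
    · exact congrArg Sum.inl (tmul_balanced g m l)
    · exact congrArg Sum.inr (tmul_balanced g n l)
  · exact fun g m l => tmul_balanced (M := M.sum N) g (Sum.inl m : M ⊕ N) l
  · exact fun g n l => tmul_balanced (M := M.sum N) g (Sum.inr n : M ⊕ N) l
  · refine tensor_ind ?_
    rintro (m | n) l <;> rfl
  · rintro (⟨⟨m, l⟩⟩ | ⟨⟨m, l⟩⟩) <;> rfl
  · intro g
    refine tensor_ind ?_
    rintro (m | n) l <;> rfl
  · intro g
    refine tensor_ind ?_
    rintro (m | n) l <;> rfl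

theorem tensor_sum (L M N : Biset G) :
    Iso (L.tensor (M.sum N)) ((L.tensor M).sum (L.tensor N)) := by
  refine ⟨⟨tensorLift (fun l (x : M ⊕ N) => Sum.map (fun m => tmul l m) (fun n => tmul l n) x) ?_,
    fun y : L.tensor M ⊕ L.tensor N => Sum.elim
      (tensorLift (fun l m => tmul (N := M.sum N) l (Sum.inl m : M ⊕ N)) ?_)
      (tensorLift (fun l n => tmul (N := M.sum N) l (Sum.inr n : M ⊕ N)) ?_) y, ?_, ?_⟩, ?_, ?_⟩
  · rintro g l (m | n)
    · exact congrArg Sum.inl (tmul_balanced g l m)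
    · exact congrArg Sum.inr (tmul_balanced g l n)
  · exact fun g l m => tmul_balanced (N := M.sum N) g l (Sum.inl m : M ⊕ N)
  · exact fun g l n => tmul_balanced (N := M.sum N) g l (Sum.inr n : M ⊕ N)
  · refine tensor_ind ?_
    rintro l (m | n) <;> rfl
  · rintro (⟨⟨m, l⟩⟩ | ⟨⟨m, l⟩⟩) <;> rfl
  · intro g
    refine tensor_ind ?_
    rintro l (m | n) <;> rfl
  · intro g
    refine tensor_ind ?_
    rintro l (m | n) <;> rfl

end Biset

/-! ### The double Burnside algebra -/

/-- Isomorphism classes of finite `(G, G)`-bisets. -/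
def BisetClass (G : Type) [Group G] : Type 1 := Quotient (Biset.setoid G)

/-- The isomorphism class of a biset. -/
def Biset.cls {G : Type} [Group G] (M : Biset G) : BisetClass G := Quotient.mk _ M

/-- Isomorphism classes of bisets form a monoid under the tensor product. -/
instance {G : Type} [Group G] [Finite G] : Monoid (BisetClass G) where
  mul := Quotient.map₂ Biset.tensor fun _ _ h _ _ k => h.tensor k
  one := (Biset.regular G).cls
  mul_assoc := by
    rintro ⟨M⟩ ⟨N⟩ ⟨L⟩
    exact Quotient.sound (Biset.tensor_assoc M N L)
  one_mul := by
    rintro ⟨M⟩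
    exact Quotient.sound (Biset.regular_tensor M)
  mul_one := by
    rintro ⟨M⟩
    exact Quotient.sound (Biset.tensor_regular M)

section Algebra

variable (R : Type) [CommRing R] (G : Type) [Group G] [Finite G]

/-- The free `R`-module on the isomorphism classes of finite `(G, G)`-bisets, with the
`R`-bilinear multiplication given on basis elements by the tensor product. -/
abbrev FreeBisetAlgebra : Type 1 := MonoidAlgebra R (BisetClass G)

/-- The relations `[M ⊔ N] - ([M] + [N])`. -/
def sumRelations : Set (FreeBisetAlgebra R G) :=
  {z | ∃ M N : Biset G, z = MonoidAlgebra.of R _ (M.sum N).cls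
    - (MonoidAlgebra.of R _ M.cls + MonoidAlgebra.of R _ N.cls)}

theorem mul_mem_span_sumRelations (a : FreeBisetAlgebra R G) {x : FreeBisetAlgebra R G}
    (hx : x ∈ Submodule.span R (sumRelations R G)) :
    a * x ∈ Submodule.span R (sumRelations R G) := by
  induction a using MonoidAlgebra.induction_on with
  | of c =>
    induction hx using Submodule.span_induction with
    | mem x h =>
      obtain ⟨M, N, rfl⟩ := h
      obtain ⟨L, rfl⟩ : ∃ L : Biset G, L.cls = c := Quotient.exists_rep c
      refine Submodule.subset_span ⟨L.tensor M, L.tensor N, ?_⟩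
      rw [mul_sub, mul_add, ← map_mul, ← map_mul, ← map_mul]
      congr 2
      exact Quotient.sound (Biset.tensor_sum L M N)
    | zero => simp
    | add x y _ _ hx hy => rw [mul_add]; exact add_mem hx hy
    | smul r x _ hx => rw [mul_smul_comm]; exact Submodule.smul_mem _ r hx
  | add a b ha hb => rw [add_mul]; exact add_mem ha hb
  | smul r a ha => rw [smul_mul_assoc]; exact Submodule.smul_mem _ r ha

theorem span_sumRelations_mul_mem {x : FreeBisetAlgebra R G} (a : FreeBisetAlgebra R G)
    (hx : x ∈ Submodule.span R (sumRelations R G)) :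
    x * a ∈ Submodule.span R (sumRelations R G) := by
  induction a using MonoidAlgebra.induction_on with
  | of c =>
    induction hx using Submodule.span_induction with
    | mem x h =>
      obtain ⟨M, N, rfl⟩ := h
      obtain ⟨L, rfl⟩ : ∃ L : Biset G, L.cls = c := Quotient.exists_rep c
      refine Submodule.subset_span ⟨M.tensor L, N.tensor L, ?_⟩
      rw [sub_mul, add_mul, ← map_mul, ← map_mul, ← map_mul]
      congr 2
      exact Quotient.sound (Biset.sum_tensor M N L)
    | zero => simp
    | add x y _ _ hx hy => rw [add_mul]; exact add_mem hx hy
    | smul r x _ hx => rw [smul_mul_assoc]; exact Submodule.smul_mem _ r hx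
  | add a b ha hb => rw [mul_add]; exact add_mem ha hb
  | smul r a ha => rw [mul_smul_comm]; exact Submodule.smul_mem _ r ha

/-- The `R`-linear span of the relations `[M ⊔ N] = [M] + [N]`; it is a two-sided ideal. -/
def sumIdeal : Ideal (FreeBisetAlgebra R G) where
  carrier := Submodule.span R (sumRelations R G)
  zero_mem' := Submodule.zero_mem _
  add_mem' := Submodule.add_mem _
  smul_mem' a _ hx := mul_mem_span_sumRelations R G a hx

instance : (sumIdeal R G).IsTwoSided :=
  ⟨fun a hx => span_sumRelations_mul_mem R G a hx⟩

/-- The double Burnside `R`-algebra `B_R(G, G)`: the `R`-module freely generated by the isomorphism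
classes of finite `(G, G)`-bisets modulo the relations `[M ⊔ N] = [M] + [N]`, with multiplication
`[M] · [N] = [M ⊗ N]`. -/
def Burnside : Type 1 := FreeBisetAlgebra R G ⧸ sumIdeal R G

instance : Ring (Burnside R G) := inferInstanceAs (Ring (FreeBisetAlgebra R G ⧸ sumIdeal R G))

instance : Algebra R (Burnside R G) :=
  inferInstanceAs (Algebra R (FreeBisetAlgebra R G ⧸ sumIdeal R G))

/-- The quotient map onto the double Burnside algebra. -/
def Burnside.mk : FreeBisetAlgebra R G →ₐ[R] Burnside R G :=
  Ideal.Quotient.mkₐ R (sumIdeal R G)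

variable {G}

/-- The class `[M]` of a biset in the double Burnside algebra. -/
def Burnside.of (M : Biset G) : Burnside R G :=
  Burnside.mk R G (MonoidAlgebra.of R _ M.cls)

theorem Burnside.of_iso {M N : Biset G} (h : Biset.Iso M N) :
    Burnside.of R M = Burnside.of R N :=
  congrArg (fun c => Burnside.mk R G (MonoidAlgebra.of R _ c)) (Quotient.sound h)

theorem Burnside.of_sum (M N : Biset G) :
    Burnside.of R (M.sum N) = Burnside.of R M + Burnside.of R N := by
  unfold Burnside.of
  rw [← map_add]
  exact (Ideal.Quotient.mk_eq_mk_iff_sub_mem _ _).2 (Submodule.subset_span ⟨M, N, rfl⟩)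

theorem Burnside.of_mul (M N : Biset G) :
    Burnside.of R M * Burnside.of R N = Burnside.of R (M.tensor N) := by
  unfold Burnside.of
  rw [← map_mul, ← map_mul]
  rfl

theorem Burnside.of_regular : Burnside.of R (Biset.regular G) = 1 := by
  unfold Burnside.of
  exact (congrArg (Burnside.mk R G) (map_one (MonoidAlgebra.of R (BisetClass G)))).trans
    (map_one _)

end Algebra

/-! ### Elements of `B_ℚ(S₃, S₃)` -/

/-- The symmetric group on three letters, acting on `{0, 1, 2}` in place of `{1, 2, 3}`. -/
abbrev S3 : Type := Equiv.Perm (Fin 3)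

/-- The double Burnside algebra `B_ℚ(S₃, S₃)`. -/
abbrev BQ : Type 1 := Burnside ℚ S3

/-- The transposition `(1, 2)`. -/
def a : S3 := Equiv.swap 0 1

/-- The three-cycle `(1, 2, 3)`. -/
def b : S3 := finRotate 3

/-! Representatives `V_i` of the conjugacy classes of subgroups of `S₃`. -/

def V0 : Subgroup S3 := ⊥
def V1 : Subgroup S3 := Subgroup.closure {a}
def V4 : Subgroup S3 := Subgroup.closure {b}
def V5 : Subgroup S3 := ⊤

/-- The diagonal subgroup `Δ(V) = {(v, v) : v ∈ V}` of `S₃ × S₃`. -/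
def diag (V : Subgroup S3) : Subgroup (S3 × S3) :=
  V.map ((MonoidHom.id S3).prod (MonoidHom.id S3))

def U6 : Subgroup (S3 × S3) := Subgroup.closure {(a, a), (1, b)}
def U7 : Subgroup (S3 × S3) := Subgroup.closure {(a, a), (b, 1)}
def U8 : Subgroup (S3 × S3) := Subgroup.closure {(a, a), (b, 1), (1, b)}

/-- The class of the transitive biset `(S₃ × S₃) / U`. -/
def H (U : Subgroup (S3 × S3)) : BQ := Burnside.of ℚ (Biset.transitive U)

/-! The basis elements: `Hij` is the class of `(S₃ × S₃) / (V_i × V_j)`, `H6`, `H7`, `H8` are those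
of `U_6`, `U_7`, `U_8`, and `HΔt` is that of `Δ(V_t)`. -/

def H00 : BQ := H (V0.prod V0)
def H01 : BQ := H (V0.prod V1)
def H04 : BQ := H (V0.prod V4)
def H05 : BQ := H (V0.prod V5)
def H10 : BQ := H (V1.prod V0)
def H11 : BQ := H (V1.prod V1)
def H14 : BQ := H (V1.prod V4)
def H15 : BQ := H (V1.prod V5)
def H40 : BQ := H (V4.prod V0)
def H41 : BQ := H (V4.prod V1)
def H44 : BQ := H (V4.prod V4)
def H45 : BQ := H (V4.prod V5)
def H50 : BQ := H (V5.prod V0)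
def H51 : BQ := H (V5.prod V1)
def H54 : BQ := H (V5.prod V4)
def H55 : BQ := H (V5.prod V5)
def H6 : BQ := H U6
def H7 : BQ := H U7
def H8 : BQ := H U8
def HΔ1 : BQ := H (diag V1)
def HΔ4 : BQ := H (diag V4)
def HΔ5 : BQ := H (diag V5)

/-! The idempotents, and bases of the Peirce components. A name `b_x_y` stands for the chosen basis
element of `x B y`, where `e`, `g`, `h` stand for `idemE`, `idemG`, `idemH` and `2`, `4` for `idem2`,
`idem4`; for `x = y = 4` the basis of `ε₄ B ε₄` is `idem4`, `b_4_4`, `c_4_4`. -/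

/-- The idempotent `e`. -/
def idemE : BQ :=
  -((1 / 2 : ℚ) • H00) + H10 + (1 / 2 : ℚ) • H40

/-- The idempotent `g`. -/
def idemG : BQ :=
  (4 / 3 : ℚ) • H00 - (2 : ℚ) • H10 - (4 / 3 : ℚ) • H01 - H40 + (2 : ℚ) • H11 + H41

/-- The idempotent `h`. -/
def idemH : BQ :=
  -((1 / 12 : ℚ) • H00) + (1 / 3 : ℚ) • H01 + (1 / 4 : ℚ) • H40 - (1 / 4 : ℚ) • H04
    + (3 / 4 : ℚ) • H44 - H41

/-- The idempotent `ε₂`. -/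
def idem2 : BQ :=
  -H00 + H10 + H01 + HΔ1 - (2 : ℚ) • H11

/-- The idempotent `ε₃`. -/
def idem3 : BQ :=
  -((1 / 4 : ℚ) • H00) + (1 / 4 : ℚ) • H40 + (1 / 4 : ℚ) • H04 + (1 / 2 : ℚ) • HΔ4
    - (3 / 4 : ℚ) • H44

/-- The idempotent `ε₄`. -/
def idem4 : BQ :=
  (1 / 2 : ℚ) • H00 - HΔ1 - (1 / 2 : ℚ) • HΔ4 + HΔ5

def b_e_g : BQ :=
  (1 / 2 : ℚ) • H00 - H10 - (1 / 2 : ℚ) • H01 - (1 / 2 : ℚ) • H40 + H11 + (1 / 2 : ℚ) • H41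

def b_e_h : BQ :=
  -((1 / 8 : ℚ) • H00) + (1 / 4 : ℚ) • H10 + (1 / 2 : ℚ) • H01 + (1 / 8 : ℚ) • H40
    - (3 / 8 : ℚ) • H04 - H11 - (1 / 2 : ℚ) • H41 + (3 / 4 : ℚ) • H14 + (3 / 8 : ℚ) • H44

def b_g_e : BQ :=
  -((4 / 3 : ℚ) • H00) + (2 : ℚ) • H10 + H40

def b_g_h : BQ :=
  -((1 / 3 : ℚ) • H00) + (1 / 2 : ℚ) • H10 + (4 / 3 : ℚ) • H01 + (1 / 4 : ℚ) • H40 - H04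
    - (2 : ℚ) • H11 - H41 + (3 / 2 : ℚ) • H14 + (3 / 4 : ℚ) • H44

def b_h_e : BQ :=
  -((1 / 3 : ℚ) • H00) + H40

def b_h_g : BQ :=
  (1 / 3 : ℚ) • H00 - (1 / 3 : ℚ) • H01 - H40 + H41

def b_e_4 : BQ :=
  -((1 / 8 : ℚ) • H00) + (1 / 4 : ℚ) • H10 + (1 / 4 : ℚ) • H01 + (1 / 8 : ℚ) • H40
    + (1 / 8 : ℚ) • H04 - (1 / 2 : ℚ) • H11 - (1 / 4 : ℚ) • H05 - (1 / 4 : ℚ) • H41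
    - (1 / 4 : ℚ) • H14 - (1 / 8 : ℚ) • H44 + (1 / 2 : ℚ) • H15 + (1 / 4 : ℚ) • H45

def b_g_4 : BQ :=
  -((1 / 3 : ℚ) • H00) + (1 / 2 : ℚ) • H10 + (2 / 3 : ℚ) • H01 + (1 / 4 : ℚ) • H40
    + (1 / 3 : ℚ) • H04 - H11 - (2 / 3 : ℚ) • H05 - (1 / 2 : ℚ) • H41 - (1 / 2 : ℚ) • H14
    - (1 / 4 : ℚ) • H44 + H15 + (1 / 2 : ℚ) • H45

def b_h_4 : BQ :=
  -((1 / 12 : ℚ) • H00) + (1 / 6 : ℚ) • H01 + (1 / 4 : ℚ) • H40 + (1 / 12 : ℚ) • H04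
    - (1 / 6 : ℚ) • H05 - (1 / 2 : ℚ) • H41 - (1 / 4 : ℚ) • H44 + (1 / 2 : ℚ) • H45

def b_2_4 : BQ :=
  -((1 / 2 : ℚ) • H00) + (1 / 2 : ℚ) • H10 + (1 / 2 : ℚ) • H01 + (1 / 2 : ℚ) • HΔ1
    + (1 / 2 : ℚ) • H04 - H11 - (1 / 2 : ℚ) • H05 - (1 / 2 : ℚ) • H6 - (1 / 2 : ℚ) • H14 + H15

def b_4_e : BQ :=
  (1 / 6 : ℚ) • H00 - (1 / 3 : ℚ) • H10 - (1 / 6 : ℚ) • H40 + (1 / 3 : ℚ) • H50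

def b_4_g : BQ :=
  -((1 / 6 : ℚ) • H00) + (1 / 3 : ℚ) • H10 + (1 / 6 : ℚ) • H01 + (1 / 6 : ℚ) • H40
    - (1 / 3 : ℚ) • H11 - (1 / 3 : ℚ) • H50 - (1 / 6 : ℚ) • H41 + (1 / 3 : ℚ) • H51

def b_4_h : BQ :=
  (1 / 24 : ℚ) • H00 - (1 / 12 : ℚ) • H10 - (1 / 6 : ℚ) • H01 - (1 / 24 : ℚ) • H40
    + (1 / 8 : ℚ) • H04 + (1 / 3 : ℚ) • H11 + (1 / 12 : ℚ) • H50 + (1 / 6 : ℚ) • H41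
    - (1 / 4 : ℚ) • H14 - (1 / 8 : ℚ) • H44 - (1 / 3 : ℚ) • H51 + (1 / 4 : ℚ) • H54

def b_4_2 : BQ :=
  -((1 / 2 : ℚ) • H00) + (1 / 2 : ℚ) • H10 + (1 / 2 : ℚ) • H01 + (1 / 2 : ℚ) • HΔ1
    + (1 / 2 : ℚ) • H40 - H11 - (1 / 2 : ℚ) • H50 - (1 / 2 : ℚ) • H41 - (1 / 2 : ℚ) • H7 + H51

def b_4_4 : BQ :=
  (1 / 24 : ℚ) • H00 - (1 / 12 : ℚ) • H10 - (1 / 12 : ℚ) • H01 - (1 / 24 : ℚ) • H40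
    - (1 / 24 : ℚ) • H04 + (1 / 6 : ℚ) • H11 + (1 / 12 : ℚ) • H50 + (1 / 12 : ℚ) • H05
    + (1 / 12 : ℚ) • H41 + (1 / 12 : ℚ) • H14 + (1 / 24 : ℚ) • H44 - (1 / 6 : ℚ) • H15
    - (1 / 6 : ℚ) • H51 - (1 / 12 : ℚ) • H45 - (1 / 12 : ℚ) • H54 + (1 / 6 : ℚ) • H55

def c_4_4 : BQ :=
  (1 / 4 : ℚ) • H00 - (3 / 4 : ℚ) • H10 - (3 / 4 : ℚ) • H01 + (1 / 4 : ℚ) • HΔ1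
    - (1 / 4 : ℚ) • H40 - (1 / 4 : ℚ) • H04 + (3 / 2 : ℚ) • H11 + (3 / 4 : ℚ) • H50
    + (3 / 4 : ℚ) • H05 - (1 / 4 : ℚ) • H6 + (3 / 4 : ℚ) • H41 + (3 / 4 : ℚ) • H14
    - (1 / 4 : ℚ) • H7 + (1 / 4 : ℚ) • H44 - (3 / 2 : ℚ) • H15 - (3 / 2 : ℚ) • H51
    - (3 / 4 : ℚ) • H45 - (3 / 4 : ℚ) • H54 + (1 / 4 : ℚ) • H8 + (3 / 2 : ℚ) • H55

/-- The idempotents `ε₁ = e + g + h`, `ε₂`, `ε₃`, `ε₄`, indexed from `0` to `3`. -/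
def eps : Fin 4 → BQ := ![idemE + idemG + idemH, idem2, idem3, idem4]

/-- The Peirce component `ε_i B ε_j = {ε_i x ε_j : x ∈ B}`. -/
def peirce (i j : Fin 4) : Submodule ℚ BQ :=
  LinearMap.range ((LinearMap.mulLeft ℚ (eps i)).comp (LinearMap.mulRight ℚ (eps j)))

/-! ### The local algebra `ℚ[η, ξ] / (η², ηξ, ξ²)` -/

/-- The ideal `(η², ηξ, ξ²)` of `ℚ[η, ξ]`, with `η = X 0` and `ξ = X 1`. -/
def etaXiIdeal : Ideal (MvPolynomial (Fin 2) ℚ) :=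
  Ideal.span {MvPolynomial.X 0 ^ 2, MvPolynomial.X 0 * MvPolynomial.X 1, MvPolynomial.X 1 ^ 2}

/-- `ℚ[η, ξ] / (η², ηξ, ξ²)`. -/
def LocAlg : Type := MvPolynomial (Fin 2) ℚ ⧸ etaXiIdeal

instance : CommRing LocAlg := inferInstanceAs (CommRing (MvPolynomial (Fin 2) ℚ ⧸ etaXiIdeal))

instance : Algebra ℚ LocAlg := inferInstanceAs (Algebra ℚ (MvPolynomial (Fin 2) ℚ ⧸ etaXiIdeal))

/-- The residue class map. -/
def LocAlg.mk : MvPolynomial (Fin 2) ℚ →ₐ[ℚ] LocAlg := Ideal.Quotient.mkₐ ℚ etaXiIdeal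

/-- The residue class of `η`. -/
def eta : LocAlg := LocAlg.mk (MvPolynomial.X 0)

/-- The residue class of `ξ`. -/
def xi : LocAlg := LocAlg.mk (MvPolynomial.X 1)

/-- The map `a + b η + c ξ ↦ (a, (b, c))` into the trivial square-zero extension of `ℚ` by `ℚ²`. -/
def toTriv : LocAlg →ₐ[ℚ] TrivSqZeroExt ℚ (ℚ × ℚ) :=
  Ideal.Quotient.liftₐ etaXiIdeal
    (MvPolynomial.aeval ![TrivSqZeroExt.inr (1, 0), TrivSqZeroExt.inr (0, 1)]) (by
      intro p hp
      have h : etaXiIdeal ≤ RingHom.ker (MvPolynomial.aeval (R := ℚ)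
          ![(TrivSqZeroExt.inr (1, 0) : TrivSqZeroExt ℚ (ℚ × ℚ)), TrivSqZeroExt.inr (0, 1)]) := by
        refine Ideal.span_le.2 ?_
        rintro x (rfl | rfl | rfl) <;> simp [RingHom.mem_ker, pow_two, TrivSqZeroExt.inr_mul_inr]
      exact h hp)

/-- The coefficient `a` of `a + b η + c ξ`. -/
def coeffOne : LocAlg →ₗ[ℚ] ℚ :=
  (TrivSqZeroExt.fstHom ℚ ℚ (ℚ × ℚ)).toLinearMap.comp toTriv.toLinearMap

/-- The coefficient `b` of `a + b η + c ξ`. -/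
def coeffEta : LocAlg →ₗ[ℚ] ℚ :=
  (LinearMap.fst ℚ ℚ ℚ).comp ((TrivSqZeroExt.sndHom ℚ (ℚ × ℚ)).comp toTriv.toLinearMap)

/-- The coefficient `c` of `a + b η + c ξ`. -/
def coeffXi : LocAlg →ₗ[ℚ] ℚ :=
  (LinearMap.snd ℚ ℚ ℚ).comp ((TrivSqZeroExt.sndHom ℚ (ℚ × ℚ)).comp toTriv.toLinearMap)

theorem toTriv_eta : toTriv eta = TrivSqZeroExt.inr (1, 0) := by
  change MvPolynomial.aeval _ (MvPolynomial.X 0) = _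
  simp

theorem toTriv_xi : toTriv xi = TrivSqZeroExt.inr (0, 1) := by
  change MvPolynomial.aeval _ (MvPolynomial.X 1) = _
  simp

theorem coeff_apply (r s t : ℚ) :
    coeffOne (r • 1 + s • eta + t • xi) = r ∧ coeffEta (r • 1 + s • eta + t • xi) = s ∧
      coeffXi (r • 1 + s • eta + t • xi) = t := by
  refine ⟨?_, ?_, ?_⟩ <;> simp [coeffOne, coeffEta, coeffXi, toTriv_eta, toTriv_xi]

theorem coeffOne_one : coeffOne 1 = 1 := by
  simp [coeffOne]

theorem coeffOne_mul (p q : LocAlg) : coeffOne (p * q) = coeffOne p * coeffOne q := by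
  simp [coeffOne]

theorem coeffOne_eta : coeffOne eta = 0 := by
  simp [coeffOne, toTriv_eta]

theorem coeffOne_xi : coeffOne xi = 0 := by
  simp [coeffOne, toTriv_xi]

theorem eta_mul_eta : eta * eta = 0 := by
  refine (Ideal.Quotient.eq_zero_iff_mem (I := etaXiIdeal)).2 (Ideal.subset_span ?_)
  simp [pow_two]

theorem eta_mul_xi : eta * xi = 0 := by
  refine (Ideal.Quotient.eq_zero_iff_mem (I := etaXiIdeal)).2 (Ideal.subset_span ?_)
  simp

theorem xi_mul_xi : xi * xi = 0 := by
  refine (Ideal.Quotient.eq_zero_iff_mem (I := etaXiIdeal)).2 (Ideal.subset_span ?_)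
  simp [pow_two]

theorem eq_coeffs (p : LocAlg) : p = coeffOne p • 1 + coeffEta p • eta + coeffXi p • xi := by
  have key : ∀ f : MvPolynomial (Fin 2) ℚ, ∃ r s t : ℚ,
      LocAlg.mk f = r • 1 + s • eta + t • xi := by
    intro f
    induction f using MvPolynomial.induction_on with
    | C r => exact ⟨r, 0, 0, by
        rw [← MvPolynomial.algebraMap_eq, AlgHom.commutes, Algebra.algebraMap_eq_smul_one]
        simp⟩
    | add f g hf hg =>
      obtain ⟨r, s, t, h⟩ := hf
      obtain ⟨r', s', t', h'⟩ := hg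
      exact ⟨r + r', s + s', t + t', by rw [map_add, h, h']; module⟩
    | mul_X f i hf =>
      obtain ⟨r, s, t, h⟩ := hf
      fin_cases i
      · refine ⟨0, r, 0, ?_⟩
        rw [map_mul, h]
        change _ * eta = _
        simp [add_mul, eta_mul_eta, mul_comm xi eta, eta_mul_xi]
      · refine ⟨0, 0, r, ?_⟩
        rw [map_mul, h]
        change _ * xi = _
        simp [add_mul, xi_mul_xi, eta_mul_xi]
  obtain ⟨f, rfl⟩ : ∃ f, LocAlg.mk f = p := Ideal.Quotient.mk_surjective p
  obtain ⟨r, s, t, h⟩ := key f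
  rw [h, (coeff_apply r s t).1, (coeff_apply r s t).2.1, (coeff_apply r s t).2.2]

theorem mul_eta (p : LocAlg) : p * eta = coeffOne p • eta := by
  conv_lhs => rw [eq_coeffs p]
  simp [add_mul, eta_mul_eta, mul_comm xi eta, eta_mul_xi]

theorem mul_xi (p : LocAlg) : p * xi = coeffOne p • xi := by
  conv_lhs => rw [eq_coeffs p]
  simp [add_mul, xi_mul_xi, eta_mul_xi]

/-! ### The algebra `A` -/

/-- The blocks `A_{i,j}`, indexed from `0` to `3`. -/
def Blk : Fin 4 → Fin 4 → Type
  | 0, 0 => Matrix (Fin 3) (Fin 3) ℚ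
  | 0, 3 => Matrix (Fin 3) (Fin 1) ℚ
  | 1, 1 => ℚ
  | 1, 3 => ℚ
  | 2, 2 => ℚ
  | 3, 0 => Matrix (Fin 1) (Fin 3) ℚ
  | 3, 1 => ℚ
  | 3, 3 => LocAlg
  | _, _ => PUnit

instance instAddCommGroupBlk : ∀ i j, AddCommGroup (Blk i j)
  | 0, 0 => inferInstanceAs (AddCommGroup (Matrix (Fin 3) (Fin 3) ℚ))
  | 0, 1 => inferInstanceAs (AddCommGroup PUnit)
  | 0, 2 => inferInstanceAs (AddCommGroup PUnit)
  | 0, 3 => inferInstanceAs (AddCommGroup (Matrix (Fin 3) (Fin 1) ℚ))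
  | 1, 0 => inferInstanceAs (AddCommGroup PUnit)
  | 1, 1 => inferInstanceAs (AddCommGroup ℚ)
  | 1, 2 => inferInstanceAs (AddCommGroup PUnit)
  | 1, 3 => inferInstanceAs (AddCommGroup ℚ)
  | 2, 0 => inferInstanceAs (AddCommGroup PUnit)
  | 2, 1 => inferInstanceAs (AddCommGroup PUnit)
  | 2, 2 => inferInstanceAs (AddCommGroup ℚ)
  | 2, 3 => inferInstanceAs (AddCommGroup PUnit)
  | 3, 0 => inferInstanceAs (AddCommGroup (Matrix (Fin 1) (Fin 3) ℚ))
  | 3, 1 => inferInstanceAs (AddCommGroup ℚ)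
  | 3, 2 => inferInstanceAs (AddCommGroup PUnit)
  | 3, 3 => inferInstanceAs (AddCommGroup LocAlg)

instance instModuleBlk : ∀ i j, Module ℚ (Blk i j)
  | 0, 0 => inferInstanceAs (Module ℚ (Matrix (Fin 3) (Fin 3) ℚ))
  | 0, 1 => inferInstanceAs (Module ℚ PUnit)
  | 0, 2 => inferInstanceAs (Module ℚ PUnit)
  | 0, 3 => inferInstanceAs (Module ℚ (Matrix (Fin 3) (Fin 1) ℚ))
  | 1, 0 => inferInstanceAs (Module ℚ PUnit)
  | 1, 1 => inferInstanceAs (Module ℚ ℚ)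
  | 1, 2 => inferInstanceAs (Module ℚ PUnit)
  | 1, 3 => inferInstanceAs (Module ℚ ℚ)
  | 2, 0 => inferInstanceAs (Module ℚ PUnit)
  | 2, 1 => inferInstanceAs (Module ℚ PUnit)
  | 2, 2 => inferInstanceAs (Module ℚ ℚ)
  | 2, 3 => inferInstanceAs (Module ℚ PUnit)
  | 3, 0 => inferInstanceAs (Module ℚ (Matrix (Fin 1) (Fin 3) ℚ))
  | 3, 1 => inferInstanceAs (Module ℚ ℚ)
  | 3, 2 => inferInstanceAs (Module ℚ PUnit)
  | 3, 3 => inferInstanceAs (Module ℚ LocAlg)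

/-- Multiplication of rational matrices as a bilinear map. -/
def matMul (l m n : ℕ) : Matrix (Fin l) (Fin m) ℚ →ₗ[ℚ] Matrix (Fin m) (Fin n) ℚ →ₗ[ℚ]
    Matrix (Fin l) (Fin n) ℚ :=
  LinearMap.mk₂ ℚ (fun X Y => X * Y) (fun _ _ _ => Matrix.add_mul _ _ _)
    (fun _ _ _ => Matrix.smul_mul _ _ _) (fun _ _ _ => Matrix.mul_add _ _ _)
    (fun _ _ _ => Matrix.mul_smul _ _ _)

/-- The bilinear map `(a + b η + c ξ, v) ↦ a v`. -/
def locSmul (V : Type) [AddCommGroup V] [Module ℚ V] : LocAlg →ₗ[ℚ] V →ₗ[ℚ] V :=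
  (LinearMap.lsmul ℚ V).comp coeffOne

/-- The `ℚ`-bilinear block multiplications `α_{i,j,k} : A_{i,j} × A_{j,k} → A_{i,k}`:
* `α₁₁₁(X, Y) = X Y`, `α₁₁₄(X, u) = X u`, `α₁₄₄(u, a + b η + c ξ) = u a`,
* `α₂₂₂(u, v) = u v`, `α₂₂₄(u, v) = u v`, `α₂₄₄(u, a + b η + c ξ) = u a`, `α₃₃₃(u, v) = u v`,
* `α₄₁₁(v, X) = v X`, `α₄₁₄(v, u) = v u η`, `α₄₂₂(u, v) = u v`, `α₄₂₄(u, v) = u v (ξ - 12 η)`,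
* `α₄₄₁(a + b η + c ξ, v) = a v`, `α₄₄₂(a + b η + c ξ, v) = a v`, `α₄₄₄(p, q) = p q`,

and all others are zero. -/
def alpha : ∀ i j k : Fin 4, Blk i j →ₗ[ℚ] Blk j k →ₗ[ℚ] Blk i k
  | 0, 0, 0 => matMul 3 3 3
  | 0, 0, 3 => matMul 3 3 1
  | 0, 3, 3 => (locSmul (Matrix (Fin 3) (Fin 1) ℚ)).flip
  | 1, 1, 1 => LinearMap.mul ℚ ℚ
  | 1, 1, 3 => LinearMap.mul ℚ ℚ
  | 1, 3, 3 => (locSmul ℚ).flip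
  | 2, 2, 2 => LinearMap.mul ℚ ℚ
  | 3, 0, 0 => matMul 1 3 3
  | 3, 0, 3 => (matMul 1 3 1).compr₂
      ((LinearMap.toSpanSingleton ℚ LocAlg eta).comp (Matrix.entryLinearMap ℚ ℚ 0 0))
  | 3, 1, 1 => LinearMap.mul ℚ ℚ
  | 3, 1, 3 => (LinearMap.mul ℚ ℚ).compr₂
      (LinearMap.toSpanSingleton ℚ LocAlg (xi - (12 : ℚ) • eta))
  | 3, 3, 0 => locSmul (Matrix (Fin 1) (Fin 3) ℚ)
  | 3, 3, 1 => locSmul ℚ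
  | 3, 3, 3 => LinearMap.mul ℚ LocAlg
  | _, _, _ => 0

/-- The entries of the identity of `A`. -/
def oneBlk : ∀ i j : Fin 4, Blk i j
  | 0, 0 => (1 : Matrix (Fin 3) (Fin 3) ℚ)
  | 1, 1 => (1 : ℚ)
  | 2, 2 => (1 : ℚ)
  | 3, 3 => (1 : LocAlg)
  | _, _ => 0

/-- The algebra `A = ⨁ A_{i,j}`, with elements written as matrices `[a_{i,j}]`. -/
def A : Type := ∀ i j : Fin 4, Blk i j

namespace A

instance : AddCommGroup A := inferInstanceAs (AddCommGroup (∀ i j, Blk i j))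

instance : Module ℚ A := inferInstanceAs (Module ℚ (∀ i j, Blk i j))

/-- `[a_{i,j}] [a'_{s,t}] = [∑_r α_{i,r,j}(a_{i,r}, a'_{r,j})]`. -/
instance : Mul A := ⟨fun x y i j => ∑ r, alpha i r j (x i r) (y r j)⟩

instance : One A := ⟨oneBlk⟩

theorem mul_apply (x y : A) (i j : Fin 4) : (x * y) i j = ∑ r, alpha i r j (x i r) (y r j) := rfl

theorem add_apply (x y : A) (i j : Fin 4) : (x + y) i j = x i j + y i j := rfl

theorem smul_apply (c : ℚ) (x : A) (i j : Fin 4) : (c • x) i j = c • x i j := rfl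

theorem zero_apply (i j : Fin 4) : (0 : A) i j = 0 := rfl

theorem one_apply (i j : Fin 4) : (1 : A) i j = oneBlk i j := rfl

end A

/-- Whether the block `A_{i,j}` is nonzero. -/
def edge : Fin 4 → Fin 4 → Bool
  | 0, 0 => true
  | 0, 3 => true
  | 1, 1 => true
  | 1, 3 => true
  | 2, 2 => true
  | 3, 0 => true
  | 3, 1 => true
  | 3, 3 => true
  | _, _ => false

theorem blk_eq_zero (i j : Fin 4) (h : ¬ edge i j = true) (x : Blk i j) : x = 0 := by
  fin_cases i <;> fin_cases j <;> first
    | exact absurd rfl h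
    | exact Subsingleton.elim (α := PUnit) _ _

theorem coeffOne_smul_eta (r : ℚ) : coeffOne (r • eta) = 0 := by
  rw [map_smul, coeffOne_eta, smul_zero]

theorem coeffOne_smul_xi (r : ℚ) : coeffOne (r • (xi - (12 : ℚ) • eta)) = 0 := by
  rw [map_smul, map_sub, map_smul, coeffOne_eta, coeffOne_xi]
  simp

theorem locSmul_smul_eta (V : Type) [AddCommGroup V] [Module ℚ V] (r : ℚ) (v : V) :
    coeffOne (r • eta) • v = 0 := by
  rw [coeffOne_smul_eta, zero_smul]

theorem locSmul_smul_xi (V : Type) [AddCommGroup V] [Module ℚ V] (r : ℚ) (v : V) :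
    coeffOne (r • (xi - (12 : ℚ) • eta)) • v = 0 := by
  rw [coeffOne_smul_xi, zero_smul]

theorem locSmul_mul (V : Type) [AddCommGroup V] [Module ℚ V] (p q : LocAlg) (v : V) :
    coeffOne (p * q) • v = coeffOne p • coeffOne q • v := by
  rw [coeffOne_mul, smul_smul]

theorem locSmul_mul' (V : Type) [AddCommGroup V] [Module ℚ V] (p q : LocAlg) (v : V) :
    coeffOne (p * q) • v = coeffOne q • coeffOne p • v := by
  rw [coeffOne_mul, smul_smul, mul_comm]

theorem assoc_0303 (u v : Matrix (Fin 3) (Fin 1) ℚ) (r : ℚ) :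
    (0 : Matrix (Fin 3) (Fin 3) ℚ) * v = coeffOne (r • eta) • u := by
  rw [Matrix.zero_mul, locSmul_smul_eta]

theorem mul_smul_eta (r : ℚ) (p : LocAlg) : p * (r • eta) = (coeffOne p * r) • eta := by
  rw [mul_smul_comm, mul_eta, smul_smul, mul_comm]

theorem mul_smul_xi (r : ℚ) (p : LocAlg) :
    p * (r • (xi - (12 : ℚ) • eta)) = (coeffOne p * r) • (xi - (12 : ℚ) • eta) := by
  rw [mul_smul_comm, mul_sub, mul_smul_comm, mul_eta, mul_xi]
  module

theorem assoc_3303 (p : LocAlg) (v : Matrix (Fin 1) (Fin 3) ℚ) (u : Matrix (Fin 3) (Fin 1) ℚ) :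
    ((coeffOne p • v) * u) 0 0 • eta = p * ((v * u) 0 0 • eta) := by
  rw [mul_smul_eta, Matrix.smul_mul]
  rfl

theorem assoc_3033 (p : LocAlg) (v : Matrix (Fin 1) (Fin 3) ℚ) (u : Matrix (Fin 3) (Fin 1) ℚ) :
    ((v * u) 0 0 • eta) * p = (v * (coeffOne p • u)) 0 0 • eta := by
  rw [mul_comm, mul_smul_eta, Matrix.mul_smul]
  rfl

theorem assoc_3313 (p : LocAlg) (u v : ℚ) : ((coeffOne p * u) * v) • (xi - (12 : ℚ) • eta) =
    p * ((u * v) • (xi - (12 : ℚ) • eta)) := by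
  rw [mul_smul_xi, mul_assoc]

theorem assoc_3133 (p : LocAlg) (u v : ℚ) : ((u * v) • (xi - (12 : ℚ) • eta)) * p =
    (u * (coeffOne p * v)) • (xi - (12 : ℚ) • eta) := by
  rw [mul_comm, mul_smul_xi, mul_left_comm]

set_option maxHeartbeats 1000000 in
theorem alpha_assoc (i j k l : Fin 4) (x : Blk i j) (y : Blk j k) (z : Blk k l) :
    alpha i k l (alpha i j k x y) z = alpha i j l x (alpha j k l y z) := by
  by_cases h₁ : edge i j = true
  swap
  · rw [blk_eq_zero i j h₁ x]; simp
  by_cases h₂ : edge j k = true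
  swap
  · rw [blk_eq_zero j k h₂ y]; simp
  by_cases h₃ : edge k l = true
  swap
  · rw [blk_eq_zero k l h₃ z]; simp
  by_cases h₄ : edge i l = true
  swap
  · rw [blk_eq_zero i l h₄ (alpha i k l _ _)]
    exact (blk_eq_zero i l h₄ _).symm
  fin_cases i <;> fin_cases j <;> first
    | exact absurd h₁ Bool.false_ne_true
    | (fin_cases k <;> first
        | exact absurd h₂ Bool.false_ne_true
        | (fin_cases l <;> first
            | exact absurd h₃ Bool.false_ne_true
            | exact absurd h₄ Bool.false_ne_true
            | skip))
  all_goals clear h₁ h₂ h₃ h₄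
  -- 0000, 0003
  · exact Matrix.mul_assoc (l := Fin 3) (m := Fin 3) (n := Fin 3) (o := Fin 3) (α := ℚ) x y z
  · exact Matrix.mul_assoc (l := Fin 3) (m := Fin 3) (n := Fin 3) (o := Fin 1) (α := ℚ) x y z
  -- 0030, 0033
  · exact (Matrix.mul_zero (m := Fin 3) (n := Fin 3) (o := Fin 3) (α := ℚ) x).symm
  · exact (Matrix.mul_smul (m := Fin 3) (n := Fin 3) (l := Fin 1) (α := ℚ) x (coeffOne z) y).symm
  -- 0300, 0303
  · exact Matrix.zero_mul (m := Fin 3) (n := Fin 3) (l := Fin 3) (α := ℚ) z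
  · exact assoc_0303 x z _
  -- 0313, 0330, 0333
  · exact (locSmul_smul_xi (Matrix (Fin 3) (Fin 1) ℚ) _ x).symm
  · rfl
  · exact (locSmul_mul' (Matrix (Fin 3) (Fin 1) ℚ) y z x).symm
  -- 1111, 1113
  · exact mul_assoc (G := ℚ) x y z
  · exact mul_assoc (G := ℚ) x y z
  -- 1131, 1133
  · exact (mul_zero (M₀ := ℚ) x).symm
  · exact mul_left_comm (G := ℚ) (coeffOne z) x y
  -- 1303
  · exact (locSmul_smul_eta ℚ _ x).symm
  -- 1311, 1313
  · exact zero_mul (M₀ := ℚ) z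
  · exact (zero_mul (M₀ := ℚ) z).trans (locSmul_smul_xi ℚ _ x).symm
  -- 1331, 1333
  · rfl
  · exact (locSmul_mul' ℚ y z x).symm
  -- 2222
  · exact mul_assoc (G := ℚ) x y z
  -- 3000, 3003
  · exact Matrix.mul_assoc (l := Fin 1) (m := Fin 3) (n := Fin 3) (o := Fin 3) (α := ℚ) x y z
  · exact congrArg (fun M : Matrix (Fin 1) (Fin 1) ℚ => M 0 0 • eta)
      (Matrix.mul_assoc (l := Fin 1) (m := Fin 3) (n := Fin 3) (o := Fin 1) (α := ℚ) x y z)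
  -- 3030, 3031, 3033
  · exact (locSmul_smul_eta (Matrix (Fin 1) (Fin 3) ℚ) _ z).trans
      (Matrix.mul_zero (m := Fin 1) (n := Fin 3) (o := Fin 3) (α := ℚ) x).symm
  · exact locSmul_smul_eta ℚ _ z
  · exact assoc_3033 z x y
  -- 3111, 3113
  · exact mul_assoc (G := ℚ) x y z
  · exact congrArg (fun r : ℚ => r • (xi - (12 : ℚ) • eta)) (mul_assoc (G := ℚ) x y z)
  -- 3130, 3131, 3133
  · exact locSmul_smul_xi (Matrix (Fin 1) (Fin 3) ℚ) _ z
  · exact (locSmul_smul_xi ℚ _ z).trans (mul_zero (M₀ := ℚ) x).symm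
  · exact assoc_3133 z x y
  -- 3300, 3303
  · exact Matrix.smul_mul (m := Fin 1) (n := Fin 3) (l := Fin 3) (α := ℚ) (coeffOne x) y z
  · exact assoc_3303 x y z
  -- 3311, 3313
  · exact mul_assoc (G := ℚ) (coeffOne x) y z
  · exact assoc_3313 x y z
  -- 3330, 3331, 3333
  · exact locSmul_mul (Matrix (Fin 1) (Fin 3) ℚ) x y z
  · exact locSmul_mul ℚ x y z
  · exact mul_assoc (G := LocAlg) x y z

theorem alpha_one_left : ∀ (i j : Fin 4) (x : Blk i j), alpha i i j (oneBlk i i) x = x := by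
  intro i j x
  by_cases h₁ : edge i j = true
  swap
  · rw [blk_eq_zero i j h₁ x]; simp
  fin_cases i <;> fin_cases j <;> first
    | exact absurd h₁ Bool.false_ne_true
    | skip
  all_goals clear h₁
  · exact Matrix.one_mul (m := Fin 3) (n := Fin 3) (α := ℚ) x
  · exact Matrix.one_mul (m := Fin 3) (n := Fin 1) (α := ℚ) x
  · exact one_mul (M := ℚ) x
  · exact one_mul (M := ℚ) x
  · exact one_mul (M := ℚ) x
  · exact (congrArg (fun r : ℚ => r • (x : Matrix (Fin 1) (Fin 3) ℚ)) coeffOne_one).trans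
      (one_smul ℚ _)
  · exact (congrArg (fun r : ℚ => r • (x : ℚ)) coeffOne_one).trans (one_smul ℚ _)
  · exact one_mul (M := LocAlg) x

theorem alpha_one_right : ∀ (i j : Fin 4) (x : Blk i j), alpha i j j x (oneBlk j j) = x := by
  intro i j x
  by_cases h₁ : edge i j = true
  swap
  · rw [blk_eq_zero i j h₁ x]; simp
  fin_cases i <;> fin_cases j <;> first
    | exact absurd h₁ Bool.false_ne_true
    | skip
  all_goals clear h₁
  · exact Matrix.mul_one (m := Fin 3) (n := Fin 3) (α := ℚ) x
  · exact (congrArg (fun r : ℚ => r • (x : Matrix (Fin 3) (Fin 1) ℚ)) coeffOne_one).trans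
      (one_smul ℚ _)
  · exact mul_one (M := ℚ) x
  · exact (congrArg (fun r : ℚ => r • (x : ℚ)) coeffOne_one).trans (one_smul ℚ _)
  · exact mul_one (M := ℚ) x
  · exact Matrix.mul_one (m := Fin 1) (n := Fin 3) (α := ℚ) x
  · exact mul_one (M := ℚ) x
  · exact mul_one (M := LocAlg) x

theorem oneBlk_ne (i j : Fin 4) (h : i ≠ j) : oneBlk i j = 0 := by
  fin_cases i <;> fin_cases j <;> first
    | exact absurd rfl h
    | rfl

namespace A

instance : Ring A where
  __ := (inferInstance : AddCommGroup A)
  __ := (inferInstance : Mul A)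
  __ := (inferInstance : One A)
  left_distrib x y z := by
    funext i j
    simp only [mul_apply, add_apply, map_add, Finset.sum_add_distrib]
  right_distrib x y z := by
    funext i j
    simp only [mul_apply, add_apply, map_add, LinearMap.add_apply, Finset.sum_add_distrib]
  zero_mul x := by
    funext i j
    simp only [mul_apply, zero_apply, map_zero, LinearMap.zero_apply, Finset.sum_const_zero]
  mul_zero x := by
    funext i j
    simp only [mul_apply, zero_apply, map_zero, Finset.sum_const_zero]
  mul_assoc x y z := by
    funext i l
    simp only [mul_apply, map_sum, LinearMap.sum_apply]
    rw [Finset.sum_comm]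
    simp only [alpha_assoc]
  one_mul x := by
    funext i j
    rw [mul_apply, Finset.sum_eq_single i]
    · exact alpha_one_left i j _
    · intro r _ hr
      rw [one_apply, oneBlk_ne i r hr.symm, map_zero, LinearMap.zero_apply]
    · exact fun h => absurd (Finset.mem_univ i) h
  mul_one x := by
    funext i j
    rw [mul_apply, Finset.sum_eq_single j]
    · exact alpha_one_right i j _
    · intro r _ hr
      rw [one_apply, oneBlk_ne r j hr, map_zero]
    · exact fun h => absurd (Finset.mem_univ j) h

instance : Algebra ℚ A :=
  Algebra.ofModule
    (fun c x y => by
      funext i j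
      simp only [mul_apply, smul_apply, map_smul, LinearMap.smul_apply, Finset.smul_sum])
    (fun c x y => by
      funext i j
      simp only [mul_apply, smul_apply, map_smul, Finset.smul_sum])

end A

/-! ### The isomorphism -/

/-- `(r_{s,t}) ↦ ∑ r_{s,t} b_{s,t}`. -/
def matComb {m n : ℕ} (B : Matrix (Fin m) (Fin n) BQ) : Matrix (Fin m) (Fin n) ℚ →ₗ[ℚ] BQ :=
  ∑ s, ∑ t, (LinearMap.toSpanSingleton ℚ BQ (B s t)).comp (Matrix.entryLinearMap ℚ ℚ s t)

/-- The linear maps `γ_{i,j} : A_{i,j} → B_ℚ(S₃, S₃)`, with values in `ε_i B ε_j`. -/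
def gammaBlk : ∀ i j : Fin 4, Blk i j →ₗ[ℚ] BQ
  | 0, 0 => matComb !![idemE, b_e_g, b_e_h; b_g_e, idemG, b_g_h; b_h_e, b_h_g, idemH]
  | 0, 3 => matComb !![b_e_4; b_g_4; b_h_4]
  | 1, 1 => LinearMap.toSpanSingleton ℚ BQ idem2
  | 1, 3 => LinearMap.toSpanSingleton ℚ BQ b_2_4
  | 2, 2 => LinearMap.toSpanSingleton ℚ BQ idem3
  | 3, 0 => matComb !![b_4_e, b_4_g, b_4_h]
  | 3, 1 => LinearMap.toSpanSingleton ℚ BQ b_4_2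
  | 3, 3 => coeffOne.smulRight idem4 + coeffEta.smulRight b_4_4 + coeffXi.smulRight c_4_4
  | _, _ => 0

end DoubleBurnside

end

noncomputable section

namespace DoubleBurnside

open MulOpposite

/-! ### Bisets as sets with an action of `G × G`: orbits, stabilizers, and the Mackey formula -/

namespace Biset

variable {G : Type} [Group G]

/-! A biset is the same thing as a left `G × G`-set, so it splits into orbits `(G × G) / U`, and
conjugate subgroups give isomorphic orbits. Hence `B = B_ℚ(S₃, S₃)` is spanned by the classes
attached to the 22 subgroups `grp k` of `S₃ × S₃`, once every subgroup is known to be conjugate to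
one of them (`exists_H_eq_hb`). These classes are independent because the table of marks, which
counts the fixed points of `grp i` on `(S₃ × S₃) / grp j`, is triangular with nonzero diagonal
(`linearIndependent_hb`). So `B` has dimension 22, and `A` is described by 9 + 3 + 1 + 1 + 1 + 3 + 1
+ 3 = 22 coordinates.

Checking multiplicativity of `γ` on all pairs of basis elements would need every product `hb i * hb
j`. Four algebra generators of `B` suffice instead: the classes of `S₃ × S₃`, `U₆`, `U₇` and
`Δ(V₄)`. For each of them the Mackey formula (`Biset.mackey`) gives its products with the 22 basis
elements. From these an explicit `c` in `A` is seen to satisfy `γ(c d) = hb s · γ(d)` for all `d`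
(`hb_mul_gammaCoord`).

The elements `x` of `B` for which some `c` satisfies both `γ(c) = x` and `γ(c d) = x γ(d)` for all
`d` form a subalgebra (`liftable`), by associativity in `A` and `B`. It contains the generators, so
it is all of `B`. In particular `γ` is surjective, and comparison of dimensions makes it injective.
The `c` belonging to `x = γ(c')` must then be `c'` itself, and the defining property of `liftable`
becomes multiplicativity of `γ` (`gammaLin_mul`).

The blockwise assertions follow by restricting `γ` to elements with a single nonzero block. Since
`ε_i` is the image of the `i`-th diagonal identity of `A`, the Peirce component `ε_i B ε_j` is the
image of the block `A_{i,j}`.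

All finite verifications in `S₃ × S₃` are made on numerical codes: elements are numbers below 36,
subgroups are bit masks, and vectors are lists of integers after clearing denominators. -/

/-- A `(G, G)`-biset as a left `G × G`-set, by `(g, h) · m = g · m · h⁻¹`. -/
@[reducible]
def prodAction (M : Biset G) : MulAction (G × G) M where
  smul p m := p.1 • op p.2⁻¹ • m
  one_smul m := by
    change (1 : G) • op (1 : G)⁻¹ • m = m
    simp
  mul_smul p q m := by
    change (p.1 * q.1) • op (p.2 * q.2)⁻¹ • m = p.1 • op p.2⁻¹ • q.1 • op q.2⁻¹ • m
    rw [mul_inv_rev, op_mul, mul_smul, mul_smul, smul_comm q.1 (op p.2⁻¹)]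

/-- The stabilizer in `G × G` of a point of a biset. -/
def stab (M : Biset G) (m : M) : Subgroup (G × G) :=
  let := M.prodAction
  MulAction.stabilizer (G × G) m

theorem mem_stab {M : Biset G} {m : M} {p : G × G} :
    p ∈ M.stab m ↔ p.1 • op p.2⁻¹ • m = m := Iff.rfl

/-- The disjoint union of a finite family of bisets. -/
def sigma {ι : Type} [Finite ι] (F : ι → Biset G) : Biset G where
  carrier := Σ i, F i

theorem sigma_congr {ι κ : Type} [Finite ι] [Finite κ] (e : ι ≃ κ) (F : κ → Biset G) :
    Iso (sigma fun i => F (e i)) (sigma F) :=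
  ⟨Equiv.sigmaCongrLeft (β := fun i => (F i).carrier) e, fun _ _ => rfl, fun _ _ => rfl⟩

theorem sigma_option {ι : Type} [Finite ι] (F : Option ι → Biset G) :
    Iso (sigma F) ((F none).sum (sigma fun i => F (some i))) := by
  refine ⟨⟨fun x => match x with
    | ⟨none, m⟩ => Sum.inl m
    | ⟨some i, m⟩ => Sum.inr ⟨i, m⟩,
    fun y : (F none : Type) ⊕ (Σ i, F (some i)) => match y with
    | Sum.inl m => ⟨none, m⟩
    | Sum.inr ⟨i, m⟩ => ⟨some i, m⟩, ?_, ?_⟩, ?_, ?_⟩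
  · rintro ⟨_ | i, m⟩ <;> rfl
  · rintro (m | ⟨i, m⟩) <;> rfl
  · rintro g ⟨_ | i, m⟩ <;> rfl
  · rintro g ⟨_ | i, m⟩ <;> rfl

theorem tmul_eq_tmul {M N : Biset G} {m m' : M} {n n' : N} :
    tmul m n = tmul m' n' ↔ ∃ g : G, m' = op g⁻¹ • m ∧ n' = g • n := by
  refine (Quotient.eq (r := tensorSetoid M N)).trans (exists_congr fun g => ?_)
  exact Prod.mk_inj

variable [Finite G]

/-- A biset is the disjoint union of the orbits of any system of orbit representatives. -/
theorem iso_sigma_stab (M : Biset G) {ι : Type} [Finite ι] (x : ι → M)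
    (hx : ∀ m, ∃! i, ∃ p : G × G, p.1 • op p.2⁻¹ • x i = m) :
    Iso (sigma fun i => transitive (M.stab (x i))) M := by
  let := M.prodAction
  let f : (Σ i, (G × G) ⧸ M.stab (x i)) → M :=
    fun y => MulAction.ofQuotientStabilizer (G × G) (x y.1) y.2
  have hf : Function.Bijective f := by
    constructor
    · rintro ⟨i, ⟨p⟩⟩ ⟨j, ⟨q⟩⟩ h
      change p • x i = q • x j at h
      obtain rfl : i = j := (hx (p • x i)).unique ⟨p, rfl⟩ ⟨q, h.symm⟩
      exact congrArg (Sigma.mk i) (MulAction.injective_ofQuotientStabilizer (G × G) (x i) h)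
    · intro m
      obtain ⟨i, ⟨p, hp⟩, -⟩ := hx m
      exact ⟨⟨i, QuotientGroup.mk p⟩, hp⟩
  refine ⟨Equiv.ofBijective f hf, ?_, ?_⟩
  · rintro g ⟨i, ⟨p⟩⟩
    change (((g, 1) : G × G) * p) • x i = g • p • x i
    rw [mul_smul]
    change g • op (1 : G)⁻¹ • p • x i = _
    simp
  · rintro g ⟨i, ⟨p⟩⟩
    change (((1, g⁻¹) : G × G) * p) • x i = op g • p • x i
    rw [mul_smul]
    change (1 : G) • op (g⁻¹)⁻¹ • p • x i = _
    simp

theorem iso_of_transitive (M : Biset G) (m : M) (h : ∀ n, ∃ p : G × G, p.1 • op p.2⁻¹ • m = n) :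
    Iso (transitive (M.stab m)) M :=
  Iso.trans ⟨(Equiv.uniqueSigma (fun _ : Unit => (transitive (M.stab m)).carrier)).symm,
      fun _ _ => rfl, fun _ _ => rfl⟩
    (iso_sigma_stab M (ι := Unit) (fun _ => m) fun n => ⟨(), h n, fun _ _ => rfl⟩)

/-- The coset of `x` as a point of `(G × G) / U`. -/
def coset (U : Subgroup (G × G)) (x : G × G) : transitive U := (QuotientGroup.mk x : (G × G) ⧸ U)

theorem coset_eq_coset {U : Subgroup (G × G)} {x y : G × G} :
    coset U x = coset U y ↔ x⁻¹ * y ∈ U := QuotientGroup.eq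

theorem coset_ind {U : Subgroup (G × G)} {P : transitive U → Prop} (h : ∀ x, P (coset U x))
    (m : transitive U) : P m := by
  obtain ⟨x⟩ := m
  exact h x

theorem smul_coset (U : Subgroup (G × G)) (g : G) (x : G × G) :
    g • coset U x = coset U (g * x.1, x.2) :=
  congrArg (coset U) (Prod.ext rfl (one_mul x.2))

theorem op_smul_coset (U : Subgroup (G × G)) (g : G) (x : G × G) :
    op g • coset U x = coset U (x.1, g⁻¹ * x.2) :=
  congrArg (coset U) (Prod.ext (one_mul x.1) rfl)

theorem mem_stab_coset {U : Subgroup (G × G)} {x p : G × G} :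
    p ∈ (transitive U).stab (coset U x) ↔ x⁻¹ * p * x ∈ U := by
  rw [mem_stab, op_smul_coset, smul_coset, eq_comm, coset_eq_coset, mul_assoc, inv_inv]
  rfl

/-- `(G × G) / U` and `(G × G) / W` are isomorphic if `W` is conjugate to `U`. -/
theorem transitive_iso_of_conj {U W : Subgroup (G × G)} (x : G × G)
    (h : ∀ p, p ∈ W ↔ x⁻¹ * p * x ∈ U) : Iso (transitive W) (transitive U) := by
  have hW : W = (transitive U).stab (coset U x) := by
    ext p
    rw [h, mem_stab_coset]
  rw [hW]
  refine iso_of_transitive _ _ (coset_ind fun y => ⟨y * x⁻¹, ?_⟩)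
  rw [op_smul_coset, smul_coset]
  congr 1
  ext <;> simp

/-- The Mackey formula, with the data of double coset representatives: `(G × G) / U ⊗ (G × G) / V`
is the disjoint union of the orbits of the points `(c, 1) U ⊗ (t, d) V`. -/
theorem mackey {U V : Subgroup (G × G)} {ι : Type} [Finite ι] (t c d : ι → G)
    (W : ι → Subgroup (G × G))
    (hW : ∀ i h p, (h, p) ∈ W i ↔ ∃ y, ((c i)⁻¹ * h * c i, y) ∈ U ∧
      ((t i)⁻¹ * y * t i, (d i)⁻¹ * p * d i) ∈ V)
    (ht : ∀ g, ∃! i, ∃ x z, x ∈ U ∧ z ∈ V ∧ g = x.2 * t i * z.1) :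
    Iso (sigma fun i => transitive (W i)) ((transitive U).tensor (transitive V)) := by
  -- The orbit of such a point depends only on `t i`. The shifts `c i` and `d i` move the point
  -- inside its orbit, so that its stabilizer is the prescribed `W i` and not merely a conjugate of
  -- it.
  let x : ι → (transitive U).tensor (transitive V) :=
    fun i => tmul (coset U (c i, 1)) (coset V (t i, d i))
  have hx : ∀ i (p : G × G), p.1 • op p.2⁻¹ • x i =
      tmul (coset U (p.1 * c i, 1)) (coset V (t i, p.2 * d i)) := fun i p => by
    rw [op_smul_tmul, smul_tmul, op_smul_coset, smul_coset, inv_inv]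
  have hW' : ∀ i, W i = ((transitive U).tensor (transitive V)).stab (x i) := by
    rintro i
    ext ⟨h, p⟩
    rw [hW, mem_stab, hx, eq_comm, tmul_eq_tmul]
    -- The group element that identifies the two tensors is `y⁻¹`, where `y` is the middle
    -- coordinate linking `U` and `V`.
    refine (Equiv.inv G).exists_congr fun y => ?_
    rw [Equiv.inv_apply, op_smul_coset, smul_coset, coset_eq_coset, eq_comm, coset_eq_coset,
      ← inv_mem_iff (x := (_, y))]
    simp [mul_assoc]
  simp only [hW']
  refine iso_sigma_stab _ x (tensor_ind (coset_ind fun u => coset_ind fun v => ?_))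
  -- The outer coordinates `u.1` and `v.2` can be moved freely by `G × G`. The remaining invariant
  -- of `u U ⊗ v V` is the double coset of `u.2⁻¹ * v.1` modulo the second projection of `U` on the
  -- left and the first projection of `V` on the right.
  refine (existsUnique_congr fun i => ?_).1 (ht (u.2⁻¹ * v.1))
  simp only [hx]
  constructor
  · rintro ⟨x, z, hxU, hz, h⟩
    refine ⟨(u.1 * x.1 * (c i)⁻¹, v.2 * z.2⁻¹ * (d i)⁻¹), tmul_eq_tmul.2 ⟨u.2 * x.2, ?_, ?_⟩⟩
    · rw [op_smul_coset, eq_comm, coset_eq_coset]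
      convert inv_mem hxU using 1
      ext <;> simp
    · rw [smul_coset, eq_comm, coset_eq_coset]
      convert hz using 1
      rw [inv_mul_eq_iff_eq_mul] at h
      ext <;> simp [h, mul_assoc]
  · rintro ⟨p, hp⟩
    obtain ⟨g, h₁, h₂⟩ := tmul_eq_tmul.1 hp
    rw [op_smul_coset, eq_comm, coset_eq_coset] at h₁
    rw [smul_coset, eq_comm, coset_eq_coset] at h₂
    refine ⟨_, _, inv_mem h₁, h₂, ?_⟩
    simp [mul_assoc]

end Biset

/-! ### Transitive bisets span the double Burnside algebra; marks -/

section

variable (R : Type) [CommRing R] {G : Type} [Group G]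

/-- An empty `M` satisfies `M ⊔ M ≅ M`, so its class equals its own double. -/
theorem Burnside.of_isEmpty (M : Biset G) [Finite G] [IsEmpty M] : Burnside.of R M = 0 := by
  have h := Burnside.of_sum R M M
  have e : Biset.Iso (M.sum M) M :=
    ⟨⟨fun x : (M : Type) ⊕ (M : Type) => x.elim id id, fun m => (isEmptyElim m : M ⊕ M),
      fun x : (M : Type) ⊕ (M : Type) => x.elim (fun m => isEmptyElim m) (fun m => isEmptyElim m),
      fun m => isEmptyElim m⟩,
      fun _ (x : (M : Type) ⊕ (M : Type)) => x.elim (fun m => isEmptyElim m) (fun m => isEmptyElim m),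
      fun _ (x : (M : Type) ⊕ (M : Type)) => x.elim (fun m => isEmptyElim m) (fun m => isEmptyElim m)⟩
  rw [Burnside.of_iso R e] at h
  simpa using h

theorem Burnside.of_sigma [Finite G] {ι : Type} [Fintype ι] (F : ι → Biset G) :
    Burnside.of R (Biset.sigma F) = ∑ i, Burnside.of R (F i) := by
  refine Fintype.induction_empty_option (P := fun ι _ => ∀ F : ι → Biset G,
    Burnside.of R (Biset.sigma F) = ∑ i, Burnside.of R (F i)) ?_ ?_ ?_ ι F
  · intro α β _ e ih F
    let := Fintype.ofEquiv β e.symm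
    rw [← Burnside.of_iso R (Biset.sigma_congr e F), ih, ← Equiv.sum_comp e]
  · intro F
    have : IsEmpty (Biset.sigma F) := inferInstanceAs (IsEmpty (Σ i, F i))
    rw [Burnside.of_isEmpty]
    simp
  · intro α _ ih F
    rw [Burnside.of_iso R (Biset.sigma_option F), Burnside.of_sum, ih, Fintype.sum_option]

/-- The double Burnside algebra is spanned by the classes of the transitive bisets. -/
theorem Burnside.span_transitive [Finite G] :
    Submodule.span R (Set.range fun U : Subgroup (G × G) =>
      Burnside.of R (Biset.transitive U)) = ⊤ := by
  rw [eq_top_iff]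
  rintro ⟨z⟩ -
  change Burnside.mk R G z ∈ _
  induction z using MonoidAlgebra.induction_on with
  | of c =>
    obtain ⟨M, rfl⟩ : ∃ M : Biset G, M.cls = c := Quotient.exists_rep c
    change Burnside.of R M ∈ _
    let := M.prodAction
    have key := Biset.iso_sigma_stab M (ι := MulAction.orbitRel.Quotient (G × G) M)
      Quotient.out fun m => by
        refine ⟨Quotient.mk _ m, ?_, ?_⟩
        · exact MulAction.mem_orbit_symm.1 (Quotient.mk_out (s := MulAction.orbitRel (G × G) M) m)
        · rintro i ⟨p, hp⟩
          rw [← Quotient.out_eq i]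
          exact Quotient.sound (s := MulAction.orbitRel (G × G) M)
            (MulAction.mem_orbit_symm.1 ⟨p, hp⟩)
    let := Fintype.ofFinite (MulAction.orbitRel.Quotient (G × G) M)
    rw [← Burnside.of_iso R key, Burnside.of_sigma]
    exact Submodule.sum_mem _ fun i _ => Submodule.subset_span ⟨_, rfl⟩
  | add a b ha hb => rw [map_add]; exact add_mem ha hb
  | smul r a ha => rw [map_smul]; exact Submodule.smul_mem _ r ha

/-- The number of points of a biset fixed by a subgroup of `G × G`. -/
def Biset.numFixed (U : Subgroup (G × G)) (M : Biset G) : ℕ :=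
  Nat.card {m : M // U ≤ M.stab m}

theorem Biset.numFixed_iso (U : Subgroup (G × G)) {M N : Biset G} (h : Biset.Iso M N) :
    Biset.numFixed U M = Biset.numFixed U N := by
  obtain ⟨f, hl, hr⟩ := h
  refine Nat.card_congr (f.subtypeEquiv fun m => forall₂_congr fun p _ => ?_)
  rw [Biset.mem_stab, Biset.mem_stab, ← hr, ← hl, f.injective.eq_iff]

theorem Biset.numFixed_sum (U : Subgroup (G × G)) (M N : Biset G) :
    Biset.numFixed U (M.sum N) = Biset.numFixed U M + Biset.numFixed U N := by
  refine (Nat.card_congr (Equiv.subtypeSum (α := M) (β := N)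
    (p := fun m => U ≤ (M.sum N).stab m))).trans ?_
  rw [Nat.card_sum]
  congr 1
  · refine Nat.card_congr (Equiv.subtypeEquivRight fun m => forall₂_congr fun p _ => ?_)
    exact Sum.inl_injective.eq_iff (a := p.1 • op p.2⁻¹ • m)
  · refine Nat.card_congr (Equiv.subtypeEquivRight fun m => forall₂_congr fun p _ => ?_)
    exact Sum.inr_injective.eq_iff (a := p.1 • op p.2⁻¹ • m)

/-- The mark of a subgroup of `G × G`: the linear form `[M] ↦ |M ^ U|`. -/
theorem Burnside.exists_mark [Finite G] (U : Subgroup (G × G)) :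
    ∃ φ : Burnside R G →ₗ[R] R, ∀ M, φ (Burnside.of R M) = Biset.numFixed U M := by
  let f : FreeBisetAlgebra R G →ₗ[R] R := (Finsupp.linearCombination R
    (Quotient.lift (fun M : Biset G => (Biset.numFixed U M : R))
      fun M N h => congrArg Nat.cast (Biset.numFixed_iso U h))).comp
      (MonoidAlgebra.coeffLinearEquiv R).toLinearMap
  have hf : ∀ M : Biset G, f (MonoidAlgebra.of R _ M.cls) = Biset.numFixed U M := fun M => by
    refine (Finsupp.linearCombination_single R 1 M.cls).trans ?_
    rw [one_smul]
    rfl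
  have hle : Submodule.span R (sumRelations R G) ≤ LinearMap.ker f := by
    refine Submodule.span_le.2 ?_
    rintro _ ⟨M, N, rfl⟩
    change f _ = 0
    rw [map_sub, map_add, hf, hf, hf, Biset.numFixed_sum, Nat.cast_add, sub_self]
  -- The underlying set of `sumIdeal` is by definition this span, so the quotient by the submodule
  -- is `Burnside R G` itself.
  exact ⟨(Submodule.span R (sumRelations R G)).liftQ f hle, hf⟩

end

/-! ### A numerical encoding of `S₃` and of the subgroups of `S₃ × S₃` -/

/-- The enumeration `b ^ i a ^ j ↦ i + 3 j` of `S₃` by the numbers less than `6`. -/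
def s3 (n : ℕ) : S3 := b ^ (n % 3) * a ^ (n / 3)

/-- The multiplication of `S₃` on codes. -/
def mulN (m n : ℕ) : ℕ := (m % 3 + (1 + m / 3) * (n % 3)) % 3 + 3 * ((m / 3 + n / 3) % 2)

/-- The inverse of `S₃` on codes. -/
def invN (n : ℕ) : ℕ := (2 - n / 3) * (n % 3) % 3 + 3 * (n / 3)

theorem mulN_lt : ∀ m < 6, ∀ n < 6, mulN m n < 6 := by decide +kernel
theorem invN_lt : ∀ n < 6, invN n < 6 := by decide +kernel
-- This is the relation `a b = b⁻¹ a`: moving `a ^ j` past a power of `b` multiplies the exponent by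
-- `(-1) ^ j`, which is `1 + j` modulo 3 for `j = 0, 1`.
theorem s3_mulN : ∀ m < 6, ∀ n < 6, s3 (mulN m n) = s3 m * s3 n := by decide +kernel
theorem s3_invN : ∀ n < 6, s3 (invN n) = (s3 n)⁻¹ := by decide +kernel
theorem s3_inj : ∀ m < 6, ∀ n < 6, s3 m = s3 n → m = n := by decide +kernel
theorem s3_surj : ∀ g : S3, ∃ n < 6, s3 n = g := by decide +kernel

/-- The enumeration of `S₃ × S₃` by the numbers less than `36`. -/
def pair (n : ℕ) : S3 × S3 := (s3 (n / 6), s3 (n % 6))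

def pmul (m n : ℕ) : ℕ := 6 * mulN (m / 6) (n / 6) + mulN (m % 6) (n % 6)

def pinv (n : ℕ) : ℕ := 6 * invN (n / 6) + invN (n % 6)

theorem pmul_lt {m n : ℕ} (hm : m < 36) (hn : n < 36) : pmul m n < 36 := by
  have := mulN_lt (m / 6) (by lia) (n / 6) (by lia)
  have := mulN_lt (m % 6) (by lia) (n % 6) (by lia)
  unfold pmul
  lia

theorem pinv_lt {n : ℕ} (hn : n < 36) : pinv n < 36 := by
  have := invN_lt (n / 6) (by lia)
  have := invN_lt (n % 6) (by lia)
  unfold pinv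
  lia

theorem pair_code {h p : ℕ} (hp : p < 6) : pair (6 * h + p) = (s3 h, s3 p) := by
  unfold pair
  rw [show (6 * h + p) / 6 = h by lia, show (6 * h + p) % 6 = p by lia]

theorem pair_pmul {m n : ℕ} (hm : m < 36) (hn : n < 36) : pair (pmul m n) = pair m * pair n := by
  rw [pmul, pair_code (mulN_lt _ (by lia) _ (by lia)), s3_mulN _ (by lia) _ (by lia),
    s3_mulN _ (by lia) _ (by lia)]
  rfl

theorem pair_pinv {n : ℕ} (hn : n < 36) : pair (pinv n) = (pair n)⁻¹ := by
  rw [pinv, pair_code (invN_lt _ (by lia)), s3_invN _ (by lia), s3_invN _ (by lia)]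
  rfl

theorem pair_surj (x : S3 × S3) : ∃ n < 36, pair n = x := by
  obtain ⟨h, hh, h'⟩ := s3_surj x.1
  obtain ⟨p, hp, p'⟩ := s3_surj x.2
  exact ⟨6 * h + p, by lia, by rw [pair_code hp, h', p']⟩

/-- Membership in the set of codes encoded by the binary digits of `m`. -/
def bit (m n : ℕ) : Bool := Nat.beq (Nat.land (Nat.shiftRight m n) 1) 1

/-- A set containing the identity and stable under left multiplication by the generators contains
the subgroup they generate. This bounds the closure from above by the mask, and `hw` bounds it from
below. -/
theorem pair_mem_closure_iff (S : Set (S3 × S3)) (m : ℕ) (h₁ : bit m 0 = true)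
    (hS : ∀ g ∈ S, ∃ n < 36, pair n = g ∧ ∀ l < 36, bit m (pmul n l) = bit m l)
    (hw : ∀ n < 36, bit m n = true → pair n ∈ Subgroup.closure S) (n : ℕ) (hn : n < 36) :
    pair n ∈ Subgroup.closure S ↔ bit m n = true := by
  refine ⟨fun h => ?_, hw n hn⟩
  suffices H : ∀ x ∈ Subgroup.closure S, ∀ n < 36, pair n = x → bit m n = true from H _ h n hn rfl
  clear h n hn
  have inj : ∀ m n, m < 36 → n < 36 → pair m = pair n → m = n := fun m n hm hn h => by
    have h₁ := s3_inj _ (by lia) _ (by lia) (congrArg Prod.fst h)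
    have h₂ := s3_inj _ (by lia) _ (by lia) (congrArg Prod.snd h)
    lia
  intro x hx
  induction hx using Subgroup.closure_induction_left with
  | one =>
    intro n hn h
    rwa [inj n 0 hn (by lia) (h.trans (by decide))]
  | mul_left g hg y hy ih =>
    intro n hn h
    obtain ⟨l, hl, rfl⟩ := pair_surj y
    obtain ⟨k, hk, rfl, H⟩ := hS g hg
    rw [inj n (pmul k l) hn (pmul_lt hk hl) (by rw [h, pair_pmul hk hl]), H l hl]
    exact ih l hl rfl
  -- Stability in `hS` is an equality of bits, so it can be read backwards and inverses of
  -- generators need no separate test.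
  | inv_mul_cancel g hg y hy ih =>
    intro n hn h
    obtain ⟨k, hk, rfl, H⟩ := hS g hg
    rw [← H n hn]
    exact ih _ (pmul_lt hk hn) (by rw [pair_pmul hk hn, h, mul_inv_cancel_left])

theorem mem_V0 : ∀ n < 6, s3 n ∈ V0 ↔ bit 1 n = true := by
  simp only [V0, Subgroup.mem_bot]
  decide +kernel

theorem mem_V5 : ∀ n < 6, s3 n ∈ V5 ↔ bit 63 n = true := by
  simp only [V5, Subgroup.mem_top, true_iff]
  decide +kernel

theorem mem_closure_singleton_iff_exists_pow {Γ : Type} [Group Γ] {g : Γ} {n : ℕ} (hn : n ≠ 0)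
    (h : g ^ n = 1) (x : Γ) : x ∈ Subgroup.closure {g} ↔ ∃ i < n, g ^ i = x := by
  rw [Subgroup.mem_closure_singleton]
  refine ⟨?_, fun ⟨i, _, hi⟩ => ⟨i, by rw [zpow_natCast, hi]⟩⟩
  rintro ⟨k, rfl⟩
  have h₀ : (0 : ℤ) < n := by lia
  have h₁ := Int.emod_nonneg k h₀.ne'
  have h₂ := Int.emod_lt_of_pos k h₀
  refine ⟨(k % n).toNat, by lia, ?_⟩
  rw [← zpow_natCast, Int.toNat_of_nonneg h₁]
  conv_rhs => rw [← Int.emod_add_mul_ediv k n, zpow_add, zpow_mul, zpow_natCast, h, one_zpow, mul_one]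

theorem mem_V1 : ∀ n < 6, s3 n ∈ V1 ↔ bit 9 n = true := by
  simp only [V1, mem_closure_singleton_iff_exists_pow two_ne_zero (by decide : a ^ 2 = 1)]
  decide +kernel

theorem mem_V4 : ∀ n < 6, s3 n ∈ V4 ↔ bit 7 n = true := by
  simp only [V4, mem_closure_singleton_iff_exists_pow three_ne_zero (by decide : b ^ 3 = 1)]
  decide +kernel

theorem pair_mem_prod {V W : Subgroup S3} {v w m : ℕ} (hV : ∀ n < 6, s3 n ∈ V ↔ bit v n = true)
    (hW : ∀ n < 6, s3 n ∈ W ↔ bit w n = true)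
    (hm : ∀ n < 36, bit m n = (bit v (n / 6) && bit w (n % 6))) (n : ℕ) (hn : n < 36) :
    pair n ∈ V.prod W ↔ bit m n = true := by
  rw [hm n hn, Bool.and_eq_true, ← hV _ (by lia), ← hW _ (by lia)]
  exact Subgroup.mem_prod

theorem pair_mem_diag {V : Subgroup S3} {v m : ℕ} (hV : ∀ n < 6, s3 n ∈ V ↔ bit v n = true)
    (hm : ∀ n < 36, bit m n = (bit v (n / 6) && Nat.beq (n / 6) (n % 6))) (n : ℕ) (hn : n < 36) :
    pair n ∈ diag V ↔ bit m n = true := by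
  rw [hm n hn, Bool.and_eq_true, ← hV _ (by lia), Nat.beq_eq]
  constructor
  · rintro ⟨x, hx, h⟩
    have h₁ : x = s3 (n / 6) := congrArg Prod.fst h
    have h₂ : x = s3 (n % 6) := congrArg Prod.snd h
    exact ⟨h₁ ▸ hx, s3_inj _ (by lia) _ (by lia) (h₁.symm.trans h₂)⟩
  · rintro ⟨hx, h⟩
    exact ⟨_, hx, Prod.ext rfl (congrArg s3 h)⟩

theorem mem_U6 : ∀ n < 36, pair n ∈ U6 ↔ bit 14680071 n = true := by
  refine pair_mem_closure_iff _ _ (by decide) ?_ fun n hn h => ?_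
  · rintro _ (rfl | rfl)
    -- Since `a` has code 3 and `b` has code 1, the pairs `(a, a)`, `(1, b)` and `(b, 1)` have codes
    -- 21, 1 and 6.
    · exact ⟨21, by lia, by decide, by decide +kernel⟩
    · exact ⟨1, by lia, by decide, by decide +kernel⟩
  · have w : ∀ n < 36, bit 14680071 n = true →
        ∃ i < 2, ∃ j < 3, pair n = (a, a) ^ i * (1, b) ^ j := by decide +kernel
    obtain ⟨i, -, j, -, h⟩ := w n hn h
    rw [h]
    exact mul_mem (pow_mem (Subgroup.subset_closure (by simp)) _)
      (pow_mem (Subgroup.subset_closure (by simp)) _)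

theorem mem_U7 : ∀ n < 36, pair n ∈ U7 ↔ bit 8726253633 n = true := by
  refine pair_mem_closure_iff _ _ (by decide) ?_ fun n hn h => ?_
  · rintro _ (rfl | rfl)
    · exact ⟨21, by lia, by decide, by decide +kernel⟩
    · exact ⟨6, by lia, by decide, by decide +kernel⟩
  · have w : ∀ n < 36, bit 8726253633 n = true →
        ∃ i < 2, ∃ j < 3, pair n = (a, a) ^ i * (b, 1) ^ j := by decide +kernel
    obtain ⟨i, -, j, -, h⟩ := w n hn h
    rw [h]
    exact mul_mem (pow_mem (Subgroup.subset_closure (by simp)) _)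
      (pow_mem (Subgroup.subset_closure (by simp)) _)

theorem mem_U8 : ∀ n < 36, pair n ∈ U8 ↔ bit 61083775431 n = true := by
  refine pair_mem_closure_iff _ _ (by decide) ?_ fun n hn h => ?_
  · rintro _ (rfl | rfl | rfl)
    · exact ⟨21, by lia, by decide, by decide +kernel⟩
    · exact ⟨6, by lia, by decide, by decide +kernel⟩
    · exact ⟨1, by lia, by decide, by decide +kernel⟩
  · have w : ∀ n < 36, bit 61083775431 n = true →
        ∃ i < 2, ∃ j < 3, ∃ k < 3, pair n = (a, a) ^ i * (b, 1) ^ j * (1, b) ^ k := by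
      decide +kernel
    obtain ⟨i, -, j, -, k, -, h⟩ := w n hn h
    rw [h]
    exact mul_mem (mul_mem (pow_mem (Subgroup.subset_closure (by simp)) _)
      (pow_mem (Subgroup.subset_closure (by simp)) _))
      (pow_mem (Subgroup.subset_closure (by simp)) _)

/-- Representatives of the conjugacy classes of subgroups of `S₃ × S₃`. -/
def grp (k : ℕ) : Subgroup (S3 × S3) :=
  [V0.prod V0, V0.prod V1, V0.prod V4, V0.prod V5, V1.prod V0, V1.prod V1, V1.prod V4, V1.prod V5,
    V4.prod V0, V4.prod V1, V4.prod V4, V4.prod V5, V5.prod V0, V5.prod V1, V5.prod V4, V5.prod V5,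
    U6, U7, U8, diag V1, diag V4, diag V5].getD k ⊥

/-- The binary codes of the subgroups `grp k`. -/
def mask (k : ℕ) : ℕ :=
  [1, 9, 7, 63, 262145, 2359305, 1835015, 16515135, 4161, 37449, 29127, 262143, 1090785345,
    9817068105, 7635497415, 68719476735, 14680071, 8726253633, 61083775431, 2097153, 16513,
    34630287489].getD k 0

theorem pair_mem_grp (k : ℕ) (hk : k < 22) :
    ∀ n < 36, pair n ∈ grp k ↔ bit (mask k) n = true := by
  interval_cases k
  · exact pair_mem_prod mem_V0 mem_V0 (by decide +kernel)
  · exact pair_mem_prod mem_V0 mem_V1 (by decide +kernel)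
  · exact pair_mem_prod mem_V0 mem_V4 (by decide +kernel)
  · exact pair_mem_prod mem_V0 mem_V5 (by decide +kernel)
  · exact pair_mem_prod mem_V1 mem_V0 (by decide +kernel)
  · exact pair_mem_prod mem_V1 mem_V1 (by decide +kernel)
  · exact pair_mem_prod mem_V1 mem_V4 (by decide +kernel)
  · exact pair_mem_prod mem_V1 mem_V5 (by decide +kernel)
  · exact pair_mem_prod mem_V4 mem_V0 (by decide +kernel)
  · exact pair_mem_prod mem_V4 mem_V1 (by decide +kernel)
  · exact pair_mem_prod mem_V4 mem_V4 (by decide +kernel)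
  · exact pair_mem_prod mem_V4 mem_V5 (by decide +kernel)
  · exact pair_mem_prod mem_V5 mem_V0 (by decide +kernel)
  · exact pair_mem_prod mem_V5 mem_V1 (by decide +kernel)
  · exact pair_mem_prod mem_V5 mem_V4 (by decide +kernel)
  · exact pair_mem_prod mem_V5 mem_V5 (by decide +kernel)
  · exact mem_U6
  · exact mem_U7
  · exact mem_U8
  · exact pair_mem_diag mem_V1 (by decide +kernel)
  · exact pair_mem_diag mem_V4 (by decide +kernel)
  · exact pair_mem_diag mem_V5 (by decide +kernel)

/-- The basis elements of `B_ℚ(S₃, S₃)`, in the order of `grp`. -/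
def hb (k : ℕ) : BQ := H (grp k)

/-! ### The classes of the transitive bisets form a basis -/

/-- Codes of generators of `grp k`. -/
def gens (k : ℕ) : List ℕ :=
  [[], [3], [1], [1, 3], [18], [18, 3], [18, 1], [18, 1, 3], [6], [6, 3], [6, 1], [6, 1, 3], [6,
  18], [6, 18, 3], [6, 18, 1], [6, 18, 1, 3], [21, 1], [21, 6], [21, 6, 1], [21], [7], [7, 21]].getD
  k []

/-- The order of `grp k`. -/
def size (k : ℕ) : ℕ :=
  [1, 2, 3, 6, 2, 4, 6, 12, 3, 6, 9, 18, 6, 12, 18, 36, 6, 6, 18, 2, 3, 6].getD k 0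

/-- Codes of the products `g₁ ^ i₁ ⋯ gᵣ ^ iᵣ` with exponents less than `3`. -/
def words : List ℕ → List ℕ
  | [] => [0]
  | g :: l => (words l) ++ (words l).map (pmul g) ++ (words l).map (pmul (pmul g g))

theorem pair_mem_of_mem_words {W : Subgroup (S3 × S3)} {l : List ℕ}
    (hl : ∀ g ∈ l, g < 36 ∧ pair g ∈ W) : ∀ n ∈ words l, n < 36 ∧ pair n ∈ W := by
  have hmul : ∀ {m n}, (m < 36 ∧ pair m ∈ W) → (n < 36 ∧ pair n ∈ W) →
      pmul m n < 36 ∧ pair (pmul m n) ∈ W := fun hm hn =>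
    ⟨pmul_lt hm.1 hn.1, pair_pmul hm.1 hn.1 ▸ mul_mem hm.2 hn.2⟩
  induction l with
  | nil =>
    intro n hn
    rw [words, List.mem_singleton] at hn
    subst hn
    exact ⟨by lia, (by decide : pair 0 = 1) ▸ one_mem W⟩
  | cons g l ih =>
    have ih' := ih fun g hg => hl g (List.mem_cons_of_mem _ hg)
    have hg := hl g List.mem_cons_self
    intro n hn
    simp only [words, List.mem_append, List.mem_map] at hn
    obtain (hn | ⟨m, hm, rfl⟩) | ⟨m, hm, rfl⟩ := hn
    · exact ih' n hn
    · exact hmul hg (ih' m hm)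
    · exact hmul (hmul hg hg) (ih' m hm)

theorem gens_lt : ∀ k < 22, ∀ g ∈ gens k, g < 36 := by decide +kernel

theorem bit_gens : ∀ k < 22, ∀ g ∈ gens k, bit (mask k) g = true := by decide +kernel

/-- This certifies that `gens k` generates `grp k`. The generators have order 2 or 3 and are listed
so that ordered products of their powers already exhaust the group. -/
theorem mem_words_gens : ∀ k < 22, ∀ n < 36, bit (mask k) n = true → n ∈ words (gens k) := by
  decide +kernel

theorem grp_le {k : ℕ} (hk : k < 22) {W : Subgroup (S3 × S3)} (h : ∀ g ∈ gens k, pair g ∈ W) :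
    grp k ≤ W := by
  intro x hx
  obtain ⟨n, hn, rfl⟩ := pair_surj x
  exact (pair_mem_of_mem_words (fun g hg => ⟨gens_lt k hk g hg, h g hg⟩) n
    (mem_words_gens k hk n hn ((pair_mem_grp k hk n hn).1 hx))).2

theorem size_le : ∀ k < 22, size k ≤ 36 := by decide

/-- If `n` is not in `grp k`, then the subgroup generated by `grp k` and `n` contains
the conjugate by `c` of `grp j`, where `36 j + c` is the entry of the table at `(k, n)`. -/
def overgroup (k n : ℕ) : ℕ :=
  ([
    [0, 72, 72, 36, 38, 37, 288, 720, 723, 306, 306, 306, 288, 723, 720, 288, 288, 288, 144, 75, 72,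
    684, 686, 685, 156, 75, 72, 696, 698, 697, 150, 75, 72, 690, 692, 691], [0, 72, 72, 0, 72, 72,
    288, 306, 306, 288, 306, 306, 288, 288, 288, 288, 288, 288, 180, 75, 72, 180, 75, 72, 192, 75,
    72, 192, 75, 72, 186, 75, 72, 186, 75, 72], [0, 0, 0, 108, 108, 108, 360, 360, 360, 378, 378,
    378, 360, 360, 360, 360, 360, 360, 216, 216, 216, 576, 576, 576, 228, 228, 228, 588, 588, 588,
    222, 222, 222, 582, 582, 582], [0, 0, 0, 0, 0, 0, 360, 360, 360, 360, 360, 360, 360, 360, 360,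
    360, 360, 360, 252, 252, 252, 252, 252, 252, 264, 264, 264, 264, 264, 264, 258, 258, 258, 258,
    258, 258], [0, 72, 72, 180, 182, 181, 288, 75, 72, 306, 306, 306, 288, 75, 72, 288, 288, 288, 0,
    72, 72, 180, 182, 181, 288, 75, 72, 306, 306, 306, 288, 75, 72, 288, 288, 288], [0, 108, 108, 0,
    108, 108, 324, 111, 108, 324, 111, 108, 324, 111, 108, 324, 111, 108, 0, 108, 108, 0, 108, 108,
    324, 111, 108, 324, 111, 108, 324, 111, 108, 324, 111, 108], [0, 0, 0, 252, 252, 252, 360, 360,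
    360, 378, 378, 378, 360, 360, 360, 360, 360, 360, 0, 0, 0, 252, 252, 252, 360, 360, 360, 378,
    378, 378, 360, 360, 360, 360, 360, 360], [0, 0, 0, 0, 0, 0, 396, 396, 396, 396, 396, 396, 396,
    396, 396, 396, 396, 396, 0, 0, 0, 0, 0, 0, 396, 396, 396, 396, 396, 396, 396, 396, 396, 396,
    396, 396], [0, 360, 360, 324, 326, 325, 0, 360, 360, 324, 326, 325, 0, 360, 360, 324, 326, 325,
    432, 363, 360, 612, 614, 613, 432, 363, 360, 612, 614, 613, 432, 363, 360, 612, 614, 613], [0,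
    360, 360, 0, 360, 360, 0, 360, 360, 0, 360, 360, 0, 360, 360, 0, 360, 360, 468, 363, 360, 468,
    363, 360, 468, 363, 360, 468, 363, 360, 468, 363, 360, 468, 363, 360], [0, 0, 0, 396, 396, 396,
    0, 0, 0, 396, 396, 396, 0, 0, 0, 396, 396, 396, 504, 504, 504, 648, 648, 648, 504, 504, 504,
    648, 648, 648, 504, 504, 504, 648, 648, 648], [0, 0, 0, 0, 0, 0, 0, 0, 0, 0, 0, 0, 0, 0, 0, 0,
    0, 0, 540, 540, 540, 540, 540, 540, 540, 540, 540, 540, 540, 540, 540, 540, 540, 540, 540, 540],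
    [0, 360, 360, 468, 470, 469, 0, 360, 360, 468, 470, 469, 0, 360, 360, 468, 470, 469, 0, 360,
    360, 468, 470, 469, 0, 360, 360, 468, 470, 469, 0, 360, 360, 468, 470, 469], [0, 396, 396, 0,
    396, 396, 0, 396, 396, 0, 396, 396, 0, 396, 396, 0, 396, 396, 0, 396, 396, 0, 396, 396, 0, 396,
    396, 0, 396, 396, 0, 396, 396, 0, 396, 396], [0, 0, 0, 540, 540, 540, 0, 0, 0, 540, 540, 540, 0,
    0, 0, 540, 540, 540, 0, 0, 0, 540, 540, 540, 0, 0, 0, 540, 540, 540, 0, 0, 0, 540, 540, 540],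
    [0, 0, 0, 0, 0, 0, 0, 0, 0, 0, 0, 0, 0, 0, 0, 0, 0, 0, 0, 0, 0, 0, 0, 0, 0, 0, 0, 0, 0, 0, 0, 0,
    0, 0, 0, 0], [0, 0, 0, 252, 252, 252, 360, 360, 360, 378, 378, 378, 360, 360, 360, 360, 360,
    360, 252, 252, 252, 0, 0, 0, 378, 378, 378, 360, 360, 360, 360, 360, 360, 360, 360, 360], [0,
    360, 360, 468, 363, 360, 0, 360, 360, 468, 363, 360, 0, 360, 360, 468, 363, 360, 468, 363, 360,
    0, 360, 360, 468, 363, 360, 0, 360, 360, 468, 363, 360, 0, 360, 360], [0, 0, 0, 540, 540, 540,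
    0, 0, 0, 540, 540, 540, 0, 0, 0, 540, 540, 540, 540, 540, 540, 0, 0, 0, 540, 540, 540, 0, 0, 0,
    540, 540, 540, 0, 0, 0], [0, 72, 72, 180, 75, 72, 288, 720, 723, 306, 75, 72, 288, 723, 720,
    288, 75, 72, 180, 75, 72, 0, 72, 72, 306, 75, 72, 288, 720, 723, 288, 75, 72, 288, 723, 720],
    [0, 360, 360, 108, 110, 109, 360, 0, 360, 110, 109, 108, 360, 360, 0, 109, 108, 110, 216, 228,
    222, 756, 758, 757, 228, 222, 216, 757, 756, 758, 222, 216, 228, 758, 757, 756], [0, 360, 360,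
    252, 266, 259, 360, 0, 360, 266, 259, 252, 360, 360, 0, 259, 252, 266, 252, 266, 259, 0, 360,
    360, 266, 259, 252, 360, 0, 360, 259, 252, 266, 360, 360, 0]].getD k []).getD n 0

/-- Three shapes of elements of the group generated by `K = grp k` and `n` suffice to reach each
generator of the conjugate of `grp j`: those in `K`, in `n K`, or in `n x n K` with `x` in `K`. -/
theorem overgroup_check : ∀ k < 22, ∀ n < 36, bit (mask k) n = false →
    overgroup k n / 36 < 22 ∧ size k < size (overgroup k n / 36) ∧
      ∀ g ∈ (gens (overgroup k n / 36)).map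
        fun g => pmul (pmul (overgroup k n % 36) g) (pinv (overgroup k n % 36)),
        bit (mask k) g = true ∨ bit (mask k) (pmul (pinv n) g) = true ∨
          ∃ x < 36, bit (mask k) x = true ∧
            bit (mask k) (pmul (pinv (pmul (pmul n x) n)) g) = true := by
  decide +kernel

/-- Any element of `U` outside `grp k` serves as the `n` of `overgroup_check`. The conclusion says
that a conjugate of the larger `grp j` lies in `U`, written as containment of `grp j` in a conjugate
of `U`. -/
theorem exists_overgroup {k : ℕ} (hk : k < 22) {U : Subgroup (S3 × S3)} (hU : grp k ≤ U)
    (hne : grp k ≠ U) : ∃ j < 22, size k < size j ∧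
      ∃ x, grp j ≤ U.comap (MulAut.conj x).toMonoidHom := by
  obtain ⟨x, hxU, hx⟩ := SetLike.exists_of_lt (lt_of_le_of_ne hU hne)
  obtain ⟨n, hn, rfl⟩ := pair_surj x
  rw [pair_mem_grp k hk n hn, Bool.not_eq_true] at hx
  obtain ⟨hj, hlt, H⟩ := overgroup_check k hk n hn hx
  have hc : overgroup k n % 36 < 36 := Nat.mod_lt _ (by lia)
  generalize overgroup k n % 36 = c at *
  generalize overgroup k n / 36 = j at *
  refine ⟨j, hj, hlt, pair c, grp_le hj fun g hg => ?_⟩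
  have hg' := gens_lt j hj g hg
  have hgc := pmul_lt (pmul_lt hc hg') (pinv_lt hc)
  change pair c * pair g * (pair c)⁻¹ ∈ U
  rw [← pair_pinv hc, ← pair_pmul hc hg', ← pair_pmul (pmul_lt hc hg') (pinv_lt hc)]
  have key : ∀ m < 36, bit (mask k) m = true → pair m ∈ U := fun m hm h =>
    hU ((pair_mem_grp k hk m hm).2 h)
  have key' : ∀ y < 36, pair y ∈ U → ∀ m < 36, bit (mask k) (pmul (pinv y) m) = true →
      pair m ∈ U := fun y hy hyU m hm h => by
    have := key _ (pmul_lt (pinv_lt hy) hm) h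
    rw [pair_pmul (pinv_lt hy) hm, pair_pinv hy] at this
    exact (Subgroup.mul_mem_cancel_left _ (inv_mem hyU)).1 this
  obtain h | h | ⟨x, hx, hxk, h⟩ := H _ (List.mem_map_of_mem hg)
  · exact key _ hgc h
  · exact key' n hn hxU _ hgc h
  -- Here the left factor to be cancelled is `n x n`, which lies in `U` because `n` and `x` do.
  · refine key' _ (pmul_lt (pmul_lt hn hx) hn) ?_ _ hgc h
    rw [pair_pmul (pmul_lt hn hx) hn, pair_pmul hn hx]
    exact mul_mem (mul_mem hxU (key x hx hxk)) hxU

theorem H_comap_conj (U : Subgroup (S3 × S3)) (x : S3 × S3) :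
    H (U.comap (MulAut.conj x).toMonoidHom) = H U :=
  Burnside.of_iso ℚ (Biset.transitive_iso_of_conj x⁻¹ fun p => by
    rw [inv_inv]
    rfl)

/-- The representatives are climbed from the trivial subgroup: as long as `grp k` is a proper
subgroup of `U`, a conjugate of `U` contains some `grp j` with larger `size`, and conjugation does
not change `H U`. The values of `size` are at most 36, so the climb stops, and it can only stop at
equality. -/
theorem exists_H_eq_hb (U : Subgroup (S3 × S3)) : ∃ k < 22, H U = hb k := by
  suffices h : ∀ m, ∀ k < 22, size k + m = 36 → ∀ U, grp k ≤ U → ∃ k < 22, H U = hb k from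
    h 35 0 (by lia) rfl U (grp_le (by lia) fun g hg => absurd hg List.not_mem_nil)
  intro m
  induction m using Nat.strong_induction_on with
  | _ m ih =>
    intro k hk hm U hU
    by_cases hne : grp k = U
    · exact ⟨k, hk, hne ▸ rfl⟩
    · obtain ⟨j, hj, hlt, x, hx⟩ := exists_overgroup hk hU hne
      have := size_le j hj
      rw [← H_comap_conj U x]
      exact ih (36 - size j) (by lia) j hj (by lia) _ hx

theorem span_hb : Submodule.span ℚ (Set.range fun k : Fin 22 => hb k) = ⊤ := by
  rw [eq_top_iff, ← Burnside.span_transitive, Submodule.span_le]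
  rintro _ ⟨U, rfl⟩
  obtain ⟨k, hk, h⟩ := exists_H_eq_hb U
  change H U ∈ _
  rw [h]
  exact Submodule.subset_span ⟨⟨k, hk⟩, rfl⟩

/-- The combinatorial content of the triangularity of the table of marks: when `size j ≤ size i` and
`i ≠ j`, each conjugate of `grp i` has an explicit generator outside `grp j`. -/
theorem not_conj_le : ∀ i < 22, ∀ j < 22, i = j ∨ size i < size j ∨ ∀ c < 36,
    ∃ g ∈ gens i, bit (mask j) (pmul (pmul (pinv c) g) c) = false := by
  decide +kernel

/-- A coset `x (grp j)` fixed by `grp i` would put `x⁻¹ (grp i) x` inside `grp j`. -/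
theorem numFixed_eq_zero {i j : ℕ} (hi : i < 22) (hj : j < 22) (hne : i ≠ j)
    (hle : size j ≤ size i) : Biset.numFixed (grp i) (Biset.transitive (grp j)) = 0 := by
  refine Nat.card_eq_zero.2 (.inl ⟨fun ⟨m, hm⟩ => ?_⟩)
  revert m
  refine Biset.coset_ind fun x hx => ?_
  obtain ⟨c, hc, rfl⟩ := pair_surj x
  obtain ⟨g, hg, h⟩ :=
    (((not_conj_le i hi j hj).resolve_left hne).resolve_left hle.not_gt) c hc
  have hg' := gens_lt i hi g hg
  have := Biset.mem_stab_coset.1 (hx ((pair_mem_grp i hi g hg').2 (bit_gens i hi g hg)))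
  rw [← pair_pinv hc, ← pair_pmul (pinv_lt hc) hg', ← pair_pmul (pmul_lt (pinv_lt hc) hg') hc,
    pair_mem_grp j hj _ (pmul_lt (pmul_lt (pinv_lt hc) hg') hc), h] at this
  exact Bool.false_ne_true this

theorem numFixed_self_ne_zero (U : Subgroup (S3 × S3)) :
    Biset.numFixed U (Biset.transitive U) ≠ 0 := by
  have : Nonempty {m : Biset.transitive U // U ≤ (Biset.transitive U).stab m} :=
    ⟨Biset.coset U 1, fun p hp => Biset.mem_stab_coset.2 (by simpa using hp)⟩
  have : Finite {m : Biset.transitive U // U ≤ (Biset.transitive U).stab m} := inferInstance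
  exact Nat.card_pos.ne'

/-- In a vanishing combination, take an index `i` of maximal `size` among those with nonzero
coefficient. The mark of `grp i` kills every other term, while its value on `hb i` is nonzero. -/
theorem linearIndependent_hb : LinearIndependent ℚ fun k : Fin 22 => hb k := by
  rw [Fintype.linearIndependent_iff]
  intro c hc
  by_contra! hne
  obtain ⟨i, hi, hmax⟩ := Finset.exists_max_image ({i | c i ≠ 0} : Finset (Fin 22))
    (fun i => size i) (by simpa [Finset.Nonempty] using hne)
  simp only [Finset.mem_filter, Finset.mem_univ, true_and] at hi hmax
  obtain ⟨φ, hφ⟩ := Burnside.exists_mark ℚ (grp i)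
  have h := congrArg φ hc
  rw [map_sum, map_zero, Finset.sum_eq_single i] at h
  · rw [map_smul, hb, H, hφ, smul_eq_mul] at h
    exact mul_ne_zero hi (Nat.cast_ne_zero.2 (numFixed_self_ne_zero (grp i))) h
  · intro j _ hj
    by_cases hj0 : c j = 0
    · rw [hj0, zero_smul, map_zero]
    · rw [map_smul, hb, H, hφ, numFixed_eq_zero i.2 j.2 (Fin.val_ne_of_ne hj.symm) (hmax j hj0),
        Nat.cast_zero, smul_zero]
  · exact fun h => absurd (Finset.mem_univ i) h

/-! ### Products of transitive bisets -/

/-- A quadruple `(t, c, d, k)` such that the point `(c, 1) U ⊗ (t, d) V` has stabilizer `grp k`, where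
`u` and `v` are the codes of `U` and `V`. -/
def IsStabDatum (u v : ℕ) (q : ℕ × ℕ × ℕ × ℕ) : Prop :=
  (q.1 < 6 ∧ q.2.1 < 6 ∧ q.2.2.1 < 6 ∧ q.2.2.2 < 22) ∧
  ∀ h < 6, ∀ p < 6, bit (mask q.2.2.2) (6 * h + p) = true ↔
    ∃ y < 6, bit u (6 * mulN (mulN (invN q.2.1) h) q.2.1 + y) = true ∧
      bit v (6 * mulN (mulN (invN q.1) y) q.1 + mulN (mulN (invN q.2.2.1) p) q.2.2.1) = true

/-- The element `g` lies in the double coset of `t`. -/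
def InDoubleCoset (u v t g : ℕ) : Prop :=
  ∃ x < 36, bit u x = true ∧ ∃ z < 36, bit v z = true ∧ g = mulN (mulN (x % 6) t) (z / 6)

/-- The list `L` describes the orbits of the tensor product of the transitive bisets of
`grp i` and `grp j`. -/
def IsMackeyDatum (i j : ℕ) (L : List (ℕ × ℕ × ℕ × ℕ)) : Prop :=
  (∀ q ∈ L, IsStabDatum (mask i) (mask j) q) ∧
  ∀ g < 6, ∃ n < L.length, ∀ m, ∀ h : m < L.length,
    InDoubleCoset (mask i) (mask j) L[m].1 g ↔ m = n

instance (u v : ℕ) (q : ℕ × ℕ × ℕ × ℕ) : Decidable (IsStabDatum u v q) := by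
  unfold IsStabDatum
  infer_instance

instance (u v t g : ℕ) : Decidable (InDoubleCoset u v t g) := by
  unfold InDoubleCoset
  infer_instance

instance (i j : ℕ) (L : List (ℕ × ℕ × ℕ × ℕ)) : Decidable (IsMackeyDatum i j L) := by
  unfold IsMackeyDatum
  infer_instance

theorem code_mem_grp {k h p : ℕ} (hk : k < 22) (hh : h < 6) (hp : p < 6) :
    (s3 h, s3 p) ∈ grp k ↔ bit (mask k) (6 * h + p) = true := by
  rw [← pair_mem_grp k hk _ (by lia), pair_code hp]

theorem s3_conj {c h : ℕ} (hc : c < 6) (hh : h < 6) :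
    s3 (mulN (mulN (invN c) h) c) = (s3 c)⁻¹ * s3 h * s3 c := by
  have h₁ := invN_lt c hc
  rw [s3_mulN _ (mulN_lt _ h₁ _ hh) _ hc, s3_mulN _ h₁ _ hh, s3_invN c hc]

theorem conj_lt {c h : ℕ} (hc : c < 6) (hh : h < 6) : mulN (mulN (invN c) h) c < 6 :=
  mulN_lt _ (mulN_lt _ (invN_lt c hc) _ hh) _ hc

/-- The Mackey formula with all its data read through the codes. The stabilizer condition and the
uniqueness of the double coset then become decidable statements about small numbers. -/
theorem hb_mul_hb {i j : ℕ} (hi : i < 22) (hj : j < 22) {L : List (ℕ × ℕ × ℕ × ℕ)}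
    (hL : IsMackeyDatum i j L) : hb i * hb j = (L.map fun q => hb q.2.2.2).sum := by
  have key := Biset.mackey (U := grp i) (V := grp j) (ι := Fin L.length)
    (fun n => s3 L[n].1) (fun n => s3 L[n].2.1) (fun n => s3 L[n].2.2.1)
    (fun n => grp L[n].2.2.2) ?_ ?_
  · rw [hb, hb, H, H, Burnside.of_mul, ← Burnside.of_iso ℚ key, Burnside.of_sigma]
    exact Fin.sum_univ_fun_getElem L fun q => hb q.2.2.2
  · intro n h p
    obtain ⟨⟨ht, hc, hd, hk⟩, H⟩ := hL.1 L[n] (List.getElem_mem _)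
    obtain ⟨h, hh, rfl⟩ := s3_surj h
    obtain ⟨p, hp, rfl⟩ := s3_surj p
    rw [code_mem_grp hk hh hp, H h hh p hp]
    constructor
    · rintro ⟨y, hy, h₁, h₂⟩
      refine ⟨s3 y, ?_, ?_⟩
      · rwa [← s3_conj hc hh, code_mem_grp hi (conj_lt hc hh) hy]
      · rwa [← s3_conj ht hy, ← s3_conj hd hp, code_mem_grp hj (conj_lt ht hy) (conj_lt hd hp)]
    · rintro ⟨y, h₁, h₂⟩
      obtain ⟨y, hy, rfl⟩ := s3_surj y
      refine ⟨y, hy, ?_, ?_⟩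
      · rwa [← s3_conj hc hh, code_mem_grp hi (conj_lt hc hh) hy] at h₁
      · rwa [← s3_conj ht hy, ← s3_conj hd hp,
          code_mem_grp hj (conj_lt ht hy) (conj_lt hd hp)] at h₂
  · intro g
    obtain ⟨g, hg, rfl⟩ := s3_surj g
    have hiff : ∀ n : Fin L.length, (∃ x z, x ∈ grp i ∧ z ∈ grp j ∧
        s3 g = x.2 * s3 L[n].1 * z.1) ↔ InDoubleCoset (mask i) (mask j) L[n].1 g := by
      intro n
      obtain ⟨⟨ht, -⟩, -⟩ := hL.1 L[n] (List.getElem_mem _)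
      have e : ∀ x < 36, ∀ z < 36, s3 (mulN (mulN (x % 6) L[n].1) (z / 6)) =
          (pair x).2 * s3 L[n].1 * (pair z).1 := fun x hx z hz => by
        rw [s3_mulN _ (mulN_lt _ (by lia) _ ht) _ (by lia), s3_mulN _ (by lia) _ ht]
        rfl
      constructor
      · rintro ⟨x, z, hx, hz, h⟩
        obtain ⟨x, hx', rfl⟩ := pair_surj x
        obtain ⟨z, hz', rfl⟩ := pair_surj z
        refine ⟨x, hx', (pair_mem_grp i hi x hx').1 hx, z, hz', (pair_mem_grp j hj z hz').1 hz, ?_⟩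
        rw [← e x hx' z hz'] at h
        exact s3_inj g hg _ (mulN_lt _ (mulN_lt _ (by lia) _ ht) _ (by lia)) h
      · rintro ⟨x, hx', hx, z, hz', hz, h⟩
        exact ⟨pair x, pair z, (pair_mem_grp i hi x hx').2 hx, (pair_mem_grp j hj z hz').2 hz,
          h ▸ e x hx' z hz'⟩
    obtain ⟨n, hn, H⟩ := hL.2 g hg
    exact ⟨⟨n, hn⟩, (hiff _).2 ((H n hn).2 rfl), fun m hm =>
      Fin.ext ((H m m.2).1 ((hiff m).1 hm))⟩

/-- The orbits of the products `hb s * hb k`, for `s = 15, 16, 17, 20`. -/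
def mackeyTable (s k : ℕ) : List (ℕ × ℕ × ℕ × ℕ) :=
  (match s with
  | 15 =>
    [[(0, 0, 0, 12)], [(0, 0, 0, 13)], [(0, 0, 0, 14)], [(0, 0, 0, 15)], [(0, 0, 0, 12)], [(0, 0, 0,
    13)], [(0, 0, 0, 14)], [(0, 0, 0, 15)], [(0, 0, 0, 12)], [(0, 0, 0, 13)], [(0, 0, 0, 14)], [(0,
    0, 0, 15)], [(0, 0, 0, 12)], [(0, 0, 0, 13)], [(0, 0, 0, 14)], [(0, 0, 0, 15)], [(0, 0, 0, 15)],
    [(0, 0, 0, 13)], [(0, 0, 0, 15)], [(0, 0, 0, 13)], [(0, 0, 0, 14)], [(0, 0, 0, 15)]]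
  | 16 =>
    [[(0, 0, 0, 0)], [(0, 0, 0, 1)], [(0, 0, 0, 2)], [(0, 0, 0, 3)], [(0, 0, 0, 4)], [(0, 0, 0, 5)],
    [(0, 0, 0, 6)], [(0, 0, 0, 7)], [(0, 0, 0, 0)], [(0, 0, 0, 1)], [(0, 0, 0, 2)], [(0, 0, 0, 3)],
    [(0, 0, 0, 4)], [(0, 0, 0, 5)], [(0, 0, 0, 6)], [(0, 0, 0, 7)], [(0, 0, 0, 16)], [(0, 0, 0,
    19)], [(0, 0, 0, 16)], [(0, 0, 0, 19)], [(0, 0, 0, 2)], [(0, 0, 0, 16)]]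
  | 17 =>
    [[(0, 0, 0, 8), (1, 0, 0, 8), (2, 0, 0, 8)], [(0, 0, 0, 9), (1, 0, 0, 9), (2, 0, 0, 9)], [(0, 0,
    0, 10), (1, 0, 0, 10), (2, 0, 0, 10)], [(0, 0, 0, 11), (1, 0, 0, 11), (2, 0, 0, 11)], [(0, 0, 0,
    12), (1, 0, 0, 8)], [(0, 0, 0, 13), (1, 0, 0, 9)], [(0, 0, 0, 14), (1, 0, 0, 10)], [(0, 0, 0,
    15), (1, 0, 0, 11)], [(0, 0, 0, 8)], [(0, 0, 0, 9)], [(0, 0, 0, 10)], [(0, 0, 0, 11)], [(0, 0,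
    0, 12)], [(0, 0, 0, 13)], [(0, 0, 0, 14)], [(0, 0, 0, 15)], [(0, 0, 0, 18), (1, 0, 0, 10)], [(0,
    0, 0, 17)], [(0, 0, 0, 18)], [(0, 0, 0, 17), (1, 0, 0, 8)], [(0, 0, 0, 8)], [(0, 0, 0, 17)]]
  | 20 =>
    [[(0, 0, 0, 0), (3, 0, 0, 0)], [(0, 0, 0, 1), (3, 0, 0, 1)], [(0, 0, 0, 2), (3, 0, 0, 2)], [(0,
    0, 0, 3), (3, 0, 0, 3)], [(0, 0, 0, 0)], [(0, 0, 0, 1)], [(0, 0, 0, 2)], [(0, 0, 0, 3)], [(0, 0,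
    0, 8), (3, 0, 0, 8)], [(0, 0, 0, 9), (3, 0, 0, 9)], [(0, 0, 0, 10), (3, 0, 0, 10)], [(0, 0, 0,
    11), (3, 0, 0, 11)], [(0, 0, 0, 8)], [(0, 0, 0, 9)], [(0, 0, 0, 10)], [(0, 0, 0, 11)], [(0, 0,
    0, 2)], [(0, 0, 0, 8)], [(0, 0, 0, 10)], [(0, 0, 0, 0)], [(0, 0, 0, 20), (3, 0, 3, 20)], [(0, 0,
    0, 20)]]
  | _ => []).getD k []

theorem isMackeyDatum_mackeyTable :
    ∀ s ∈ [15, 16, 17, 20], ∀ k < 22, IsMackeyDatum s k (mackeyTable s k) := by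
  decide +kernel

theorem hb_mul_hb_mackeyTable {s k : ℕ} (hs : s ∈ [15, 16, 17, 20]) (hk : k < 22) :
    hb s * hb k = ((mackeyTable s k).map fun q => hb q.2.2.2).sum :=
  hb_mul_hb ((by decide : ∀ s ∈ [15, 16, 17, 20], s < 22) s hs) hk
    (isMackeyDatum_mackeyTable s hs k hk)

/-! ### Integral combinations with list coefficients -/

section ListComb

variable {M : Type*} [AddCommGroup M]

/-- `evalL f [c₀, c₁, …] = c₀ f(0) + c₁ f(1) + ⋯`. -/
def evalL (f : ℕ → M) : List ℤ → M
  | [] => 0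
  | c :: l => c • f 0 + evalL (fun n => f (n + 1)) l

def addL : List ℤ → List ℤ → List ℤ
  | [], l => l
  | c :: l, [] => c :: l
  | c :: l, d :: m => (c + d) :: addL l m

def smulL (c : ℤ) (l : List ℤ) : List ℤ := l.map (c * ·)

/-- The combination of the rows `R 0, R 1, …` with the given coefficients. -/
def linComb (R : ℕ → List ℤ) : List ℤ → List ℤ
  | [] => []
  | c :: l => addL (smulL c (R 0)) (linComb (fun n => R (n + 1)) l)

theorem evalL_addL (f : ℕ → M) (l m : List ℤ) : evalL f (addL l m) = evalL f l + evalL f m := by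
  induction l generalizing f m with
  | nil => simp [addL, evalL]
  | cons c l ih =>
    cases m with
    | nil => simp [addL, evalL]
    | cons d m =>
      simp only [addL, evalL, ih, add_smul]
      abel

theorem evalL_smulL (f : ℕ → M) (c : ℤ) (l : List ℤ) : evalL f (smulL c l) = c • evalL f l := by
  induction l generalizing f with
  | nil => simp [smulL, evalL]
  | cons d l ih =>
    change (c * d) • f 0 + evalL _ (smulL c l) = _
    rw [ih, evalL, smul_add, mul_smul]

theorem evalL_linComb (f : ℕ → M) (R : ℕ → List ℤ) (l : List ℤ) :
    evalL f (linComb R l) = evalL (fun k => evalL f (R k)) l := by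
  induction l generalizing R with
  | nil => rfl
  | cons c l ih => rw [linComb, evalL_addL, evalL_smulL, ih, evalL]

theorem evalL_congr {f g : ℕ → M} {l : List ℤ} (h : ∀ k < l.length, f k = g k) :
    evalL f l = evalL g l := by
  induction l generalizing f g with
  | nil => rfl
  | cons c l ih =>
    rw [evalL, evalL, h 0 (Nat.succ_pos _), ih fun k hk => h _ (Nat.succ_lt_succ hk)]

theorem map_evalL {N : Type*} [AddCommGroup N] (φ : M →+ N) (f : ℕ → M) (l : List ℤ) :
    φ (evalL f l) = evalL (fun k => φ (f k)) l := by
  induction l generalizing f with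
  | nil => exact map_zero φ
  | cons c l ih => rw [evalL, map_add, map_zsmul, ih, evalL]

theorem evalL_eq_zero (f : ℕ → M) {l : List ℤ} (h : ∀ c ∈ l, c = 0) : evalL f l = 0 := by
  induction l generalizing f with
  | nil => rfl
  | cons c l ih =>
    rw [evalL, h c List.mem_cons_self, ih _ fun d hd => h d (List.mem_cons_of_mem _ hd),
      zero_smul, zero_add]

/-- Lists are compared through their difference, not literally, because trailing zeros are dropped
and equal vectors may have different lengths. -/
theorem evalL_eq_of_sub (f : ℕ → M) {l m : List ℤ} (h : ∀ c ∈ addL l (smulL (-1) m), c = 0) :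
    evalL f l = evalL f m := by
  have := evalL_eq_zero f h
  rwa [evalL_addL, evalL_smulL, neg_one_zsmul, ← sub_eq_add_neg, sub_eq_zero] at this

theorem evalL_ofFn (f : ℕ → M) (n : ℕ) (c : Fin n → ℤ) :
    evalL f (List.ofFn c) = ∑ i, c i • f i := by
  induction n generalizing f with
  | zero => rfl
  | succ n ih =>
    rw [List.ofFn_succ, evalL, ih, Fin.sum_univ_succ]
    rfl

/-- The `k`-th unit vector. -/
def unitL (k : ℕ) : List ℤ := List.replicate k 0 ++ [1]

theorem evalL_unitL (f : ℕ → M) (k : ℕ) : evalL f (unitL k) = f k := by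
  induction k generalizing f with
  | zero => simp [unitL, evalL]
  | succ k ih =>
    change (0 : ℤ) • f 0 + evalL _ (unitL k) = _
    rw [ih, zero_smul, zero_add]

end ListComb

/-! ### The matrix algebra in coordinates -/

/-- The structure constants of `A` in the coordinates given by `toA`: the terms `c v_i w_j` of
the `k`-th coordinate of the product of `v` and `w`. -/
def mulTerms (k : ℕ) : List (ℤ × Fin 22 × Fin 22) :=
  match k with
  | 0 => [(1, 0, 0), (1, 1, 3), (1, 2, 6)]
  | 1 => [(1, 0, 1), (1, 1, 4), (1, 2, 7)]
  | 2 => [(1, 0, 2), (1, 1, 5), (1, 2, 8)]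
  | 3 => [(1, 3, 0), (1, 4, 3), (1, 5, 6)]
  | 4 => [(1, 3, 1), (1, 4, 4), (1, 5, 7)]
  | 5 => [(1, 3, 2), (1, 4, 5), (1, 5, 8)]
  | 6 => [(1, 6, 0), (1, 7, 3), (1, 8, 6)]
  | 7 => [(1, 6, 1), (1, 7, 4), (1, 8, 7)]
  | 8 => [(1, 6, 2), (1, 7, 5), (1, 8, 8)]
  | 9 => [(1, 0, 9), (1, 1, 10), (1, 2, 11), (1, 9, 19)]
  | 10 => [(1, 3, 9), (1, 4, 10), (1, 5, 11), (1, 10, 19)]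
  | 11 => [(1, 6, 9), (1, 7, 10), (1, 8, 11), (1, 11, 19)]
  | 12 => [(1, 12, 12)]
  | 13 => [(1, 12, 13), (1, 13, 19)]
  | 14 => [(1, 14, 14)]
  | 15 => [(1, 15, 0), (1, 16, 3), (1, 17, 6), (1, 19, 15)]
  | 16 => [(1, 15, 1), (1, 16, 4), (1, 17, 7), (1, 19, 16)]
  | 17 => [(1, 15, 2), (1, 16, 5), (1, 17, 8), (1, 19, 17)]
  | 18 => [(1, 18, 12), (1, 19, 18)]
  | 19 => [(1, 19, 19)]
  | 20 => [(1, 19, 20), (1, 20, 19), (1, 15, 9), (1, 16, 10), (1, 17, 11), (-12, 18, 13)]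
  | 21 => [(1, 19, 21), (1, 21, 19), (1, 18, 13)]
  | _ => []

/-- The multiplication of `A` in the coordinates given by `toA`. -/
def mulA {R : Type*} [CommRing R] (v w : Fin 22 → R) (k : Fin 22) : R :=
  ((mulTerms k).map fun t => (t.1 : R) * v t.2.1 * w t.2.2).sum

/-- The images under `γ` of the standard basis of `A`. -/
def gb (k : ℕ) : BQ :=
  [idemE, b_e_g, b_e_h, b_g_e, idemG, b_g_h, b_h_e, b_h_g, idemH, b_e_4, b_g_4, b_h_4, idem2, b_2_4,
  idem3, b_4_e, b_4_g, b_4_h, b_4_2, idem4, b_4_4, c_4_4].getD k 0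

/-- The coefficients of `24 • gb k` in the basis `hb`. -/
def gammaRow (k : ℕ) : List ℤ :=
  ([
    [-12, 0, 0, 0, 24, 0, 0, 0, 12],
    [12, -12, 0, 0, -24, 24, 0, 0, -12, 12],
    [-3, 12, -9, 0, 6, -24, 18, 0, 3, -12, 9],
    [-32, 0, 0, 0, 48, 0, 0, 0, 24],
    [32, -32, 0, 0, -48, 48, 0, 0, -24, 24],
    [-8, 32, -24, 0, 12, -48, 36, 0, 6, -24, 18],
    [-8, 0, 0, 0, 0, 0, 0, 0, 24],
    [8, -8, 0, 0, 0, 0, 0, 0, -24, 24],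
    [-2, 8, -6, 0, 0, 0, 0, 0, 6, -24, 18],
    [-3, 6, 3, -6, 6, -12, -6, 12, 3, -6, -3, 6],
    [-8, 16, 8, -16, 12, -24, -12, 24, 6, -12, -6, 12],
    [-2, 4, 2, -4, 0, 0, 0, 0, 6, -12, -6, 12],
    [-24, 24, 0, 0, 24, -48, 0, 0, 0, 0, 0, 0, 0, 0, 0, 0, 0, 0, 0, 24],
    [-12, 12, 12, -12, 12, -24, -12, 24, 0, 0, 0, 0, 0, 0, 0, 0, -12, 0, 0, 12],
    [-6, 0, 6, 0, 0, 0, 0, 0, 6, 0, -18, 0, 0, 0, 0, 0, 0, 0, 0, 0, 12],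
    [4, 0, 0, 0, -8, 0, 0, 0, -4, 0, 0, 0, 8],
    [-4, 4, 0, 0, 8, -8, 0, 0, 4, -4, 0, 0, -8, 8],
    [1, -4, 3, 0, -2, 8, -6, 0, -1, 4, -3, 0, 2, -8, 6],
    [-12, 12, 0, 0, 12, -24, 0, 0, 12, -12, 0, 0, -12, 24, 0, 0, 0, -12, 0, 12],
    [12, 0, 0, 0, 0, 0, 0, 0, 0, 0, 0, 0, 0, 0, 0, 0, 0, 0, 0, -24, -12, 24],
    [1, -2, -1, 2, -2, 4, 2, -4, -1, 2, 1, -2, 2, -4, -2, 4],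
    [6, -18, -6, 18, -18, 36, 18, -36, -6, 18, 6, -18, 18, -36, -18, 36, -6, -6, 6, 6]].getD k [])

-- The number 24 is a common denominator of all coefficients in the definitions of the idempotents
-- and of the `b_x_y`; clearing it makes the later checks integral.
set_option maxHeartbeats 1000000 in
theorem smul_gb (k : ℕ) (hk : k < 22) : (24 : ℤ) • gb k = evalL hb (gammaRow k) := by
  have h00 : hb 0 = H00 := rfl
  have h01 : hb 1 = H01 := rfl
  have h04 : hb 2 = H04 := rfl
  have h05 : hb 3 = H05 := rfl
  have h10 : hb 4 = H10 := rfl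
  have h11 : hb 5 = H11 := rfl
  have h14 : hb 6 = H14 := rfl
  have h15 : hb 7 = H15 := rfl
  have h40 : hb 8 = H40 := rfl
  have h41 : hb 9 = H41 := rfl
  have h44 : hb 10 = H44 := rfl
  have h45 : hb 11 = H45 := rfl
  have h50 : hb 12 = H50 := rfl
  have h51 : hb 13 = H51 := rfl
  have h54 : hb 14 = H54 := rfl
  have h55 : hb 15 = H55 := rfl
  have h6 : hb 16 = H6 := rfl
  have h7 : hb 17 = H7 := rfl
  have h8 : hb 18 = H8 := rfl
  have hD1 : hb 19 = HΔ1 := rfl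
  have hD4 : hb 20 = HΔ4 := rfl
  have hD5 : hb 21 = HΔ5 := rfl
  interval_cases k <;>
    simp only [gb, gammaRow, List.getD_cons_zero, List.getD_cons_succ, evalL, Nat.reduceAdd,
      zero_add,
      h00, h01, h04, h05, h10, h11, h14, h15, h40, h41, h44, h45, h50, h51, h54, h55, h6, h7, h8,
      hD1, hD4, hD5, idemE, b_e_g, b_e_h, b_g_e, idemG, b_g_h, b_h_e, b_h_g, idemH, b_e_4, b_g_4,
      b_h_4, idem2, b_2_4, idem3, b_4_e, b_4_g, b_4_h, b_4_2, idem4, b_4_4, c_4_4] <;>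
    module

/-! ### Left multiplication by the four generators in the coordinates of `A` -/

/-- The coefficients of `6 • hb s` in the basis `gb`. -/
def sigmaRow (s : ℕ) : Fin 22 → ℤ :=
  match s with
  | 15 => ![6, 10, 4, 0, 0, 0, 0, 0, 0, 12, 0, 0, 0, 0, 0, 18, 30, 12, 0, 0, 36, 0]
  | 16 => ![18, 24, 24, -6, -6, -12, -3, -6, 0, 0, 12, -12, 6, -12, 0, 0, 0, 0, 0, 0, 0, 0]
  | 17 => ![6, 0, 0, 0, 6, 0, 0, -6, 0, 0, 0, 0, 6, 0, 0, 18, 36, 0, -12, 0, 0, 0]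
  | 20 => ![12, 0, 0, -6, 0, 0, 6, 12, 12, 0, 0, 0, 0, 0, 12, 0, 0, 0, 0, 0, 0, 0]
  | _ => 0

/-- The coefficients of `hb s * hb k` in the basis `hb`, for `s = 15, 16, 17, 20`. -/
def mulRow (s k : ℕ) : List ℤ :=
  (mackeyTable s k).foldr (fun q l => addL (unitL q.2.2.2) l) []

theorem hb_mul_hb_mulRow {s k : ℕ} (hs : s ∈ [15, 16, 17, 20]) (hk : k < 22) :
    hb s * hb k = evalL hb (mulRow s k) := by
  rw [hb_mul_hb_mackeyTable hs hk, mulRow]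
  induction mackeyTable s k with
  | nil => rfl
  | cons q L ih => rw [List.map_cons, List.sum_cons, ih, List.foldr_cons, evalL_addL, evalL_unitL]

/-- The product rule for `hb s * hb k` requires `k < 22`, so rows must not extend beyond that range.
-/
theorem length_gammaRow : ∀ k < 22, (gammaRow k).length ≤ 22 := by decide +kernel

/-- The computational core. Left multiplication by `hb s` on `gb i` is computed once in `B`, from
the Mackey tables, and once in `A`, from the structure constants. Both results, scaled by 24 · 6,
are expanded in the basis `hb` and compared. -/
theorem mulRow_check : ∀ s ∈ [15, 16, 17, 20], ∀ i : Fin 22,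
    ∀ c ∈ addL (smulL 6 (linComb (mulRow s) (gammaRow i))) (smulL (-1)
      (linComb gammaRow (List.ofFn (mulA (sigmaRow s) fun j => if j = i then 1 else 0)))), c = 0 := by
  decide +kernel

theorem hb_mul_gb {s : ℕ} (hs : s ∈ [15, 16, 17, 20]) (i : Fin 22) :
    (6 : ℤ) • (hb s * gb i) =
      ∑ j : Fin 22, mulA (sigmaRow s) (fun j => if j = i then 1 else 0) j • gb j := by
  have h := evalL_eq_of_sub hb (mulRow_check s hs i)
  have hl : evalL hb (linComb (mulRow s) (gammaRow i)) = (24 : ℤ) • (hb s * gb i) := by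
    rw [← mul_smul_comm, smul_gb i i.2, ← AddMonoidHom.coe_mulLeft, map_evalL, evalL_linComb]
    exact (evalL_congr fun k hk =>
      hb_mul_hb_mulRow hs (hk.trans_le (length_gammaRow i i.2))).symm
  have hr : evalL hb (linComb gammaRow (List.ofFn
      (mulA (sigmaRow s) fun j => if j = i then 1 else 0))) =
      (24 : ℤ) • ∑ j : Fin 22, mulA (sigmaRow s) (fun j => if j = i then 1 else 0) j • gb j := by
    rw [evalL_linComb, evalL_ofFn, Finset.smul_sum]
    exact Finset.sum_congr rfl fun j _ => by rw [← smul_gb j j.2, smul_comm]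
  rw [evalL_smulL, hl, hr] at h
  have h' := congrArg (fun x : BQ => (1 / 24 : ℚ) • x) h
  rw [smul_comm (6 : ℤ) (24 : ℤ)] at h'
  have e : ∀ x : BQ, (1 / 24 : ℚ) • (24 : ℤ) • x = x := fun x => by module
  rwa [e, e] at h'

/-- Carries the integral check over to rational coordinates; the left factor keeps the denominator
of `sigmaRow`. -/
theorem mulA_cast_div (v w : Fin 22 → ℤ) (d : ℚ) (k : Fin 22) :
    mulA (fun k => (v k : ℚ) / d) (fun k => (w k : ℚ)) k = ((mulA v w k : ℤ) : ℚ) / d := by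
  unfold mulA
  induction mulTerms k with
  | nil => simp
  | cons t l ih =>
    rw [List.map_cons, List.map_cons, List.sum_cons, List.sum_cons, ih]
    push_cast
    ring

/-- Left multiplication by `v` in the coordinates of `A`. -/
def mulLeftA (v : Fin 22 → ℚ) : (Fin 22 → ℚ) →ₗ[ℚ] (Fin 22 → ℚ) where
  toFun := mulA v
  map_add' w w' := by
    funext k
    simp only [mulA, Pi.add_apply, mul_add, List.sum_map_add]
  map_smul' c w := by
    funext k
    simp only [mulA, Pi.smul_apply, smul_eq_mul, RingHom.id_apply, ← List.sum_map_mul_left,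
      mul_left_comm]

/-- The map `γ` in the coordinates of `A`. -/
def gammaCoord : (Fin 22 → ℚ) →ₗ[ℚ] BQ := Fintype.linearCombination ℚ fun k : Fin 22 => gb k

/-- Both sides are linear in `w`, so the case of unit vectors, which is `hb_mul_gb`, is enough. -/
theorem hb_mul_gammaCoord {s : ℕ} (hs : s ∈ [15, 16, 17, 20]) (w : Fin 22 → ℚ) :
    hb s * gammaCoord w = gammaCoord (mulA (fun k => (sigmaRow s k : ℚ) / 6) w) := by
  suffices h : (LinearMap.mulLeft ℚ (hb s)).comp gammaCoord =
      gammaCoord.comp (mulLeftA fun k => (sigmaRow s k : ℚ) / 6) from LinearMap.congr_fun h w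
  refine (Pi.basisFun ℚ (Fin 22)).ext fun i => ?_
  have hi : Pi.basisFun ℚ (Fin 22) i = fun j => (((if j = i then 1 else 0 : ℤ)) : ℚ) := by
    funext j
    simp [Pi.single_apply]
  have h₁ : gammaCoord (Pi.basisFun ℚ (Fin 22) i) = gb i := by
    rw [Pi.basisFun_apply, gammaCoord, Fintype.linearCombination_apply_single, one_smul]
  have hm : ∀ v w, mulLeftA v w = mulA v w := fun _ _ => rfl
  rw [LinearMap.comp_apply, LinearMap.comp_apply, LinearMap.mulLeft_apply, hm]
  have e : ∀ x : BQ, x = (1 / 6 : ℚ) • (6 : ℤ) • x := fun x => by module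
  rw [h₁, hi, e (hb s * gb i), hb_mul_gb hs i, gammaCoord, Fintype.linearCombination_apply,
    Finset.smul_sum]
  refine Finset.sum_congr rfl fun j _ => ?_
  rw [mulA_cast_div]
  module

/-! ### Comparison of the coordinates with the blocks of `A` -/

/-- The element of `A` with the given coordinates. -/
def toA (v : Fin 22 → ℚ) : A := fun i j =>
  match i, j with
  | 0, 0 => (!![v 0, v 1, v 2; v 3, v 4, v 5; v 6, v 7, v 8] : Matrix (Fin 3) (Fin 3) ℚ)
  | 0, 1 => 0
  | 0, 2 => 0
  | 0, 3 => (!![v 9; v 10; v 11] : Matrix (Fin 3) (Fin 1) ℚ)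
  | 1, 0 => 0
  | 1, 1 => (v 12 : ℚ)
  | 1, 2 => 0
  | 1, 3 => (v 13 : ℚ)
  | 2, 0 => 0
  | 2, 1 => 0
  | 2, 2 => (v 14 : ℚ)
  | 2, 3 => 0
  | 3, 0 => (!![v 15, v 16, v 17] : Matrix (Fin 1) (Fin 3) ℚ)
  | 3, 1 => (v 18 : ℚ)
  | 3, 2 => 0
  | 3, 3 => (v 19 • 1 + v 20 • eta + v 21 • xi : LocAlg)

theorem A_ext {x y : A} (h₀₀ : x 0 0 = y 0 0) (h₀₃ : x 0 3 = y 0 3) (h₁₁ : x 1 1 = y 1 1)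
    (h₁₃ : x 1 3 = y 1 3) (h₂₂ : x 2 2 = y 2 2) (h₃₀ : x 3 0 = y 3 0) (h₃₁ : x 3 1 = y 3 1)
    (h₃₃ : x 3 3 = y 3 3) : x = y := by
  funext i j
  by_cases h : edge i j = true
  swap
  · rw [blk_eq_zero i j h (x i j), blk_eq_zero i j h (y i j)]
  fin_cases i <;> fin_cases j <;> first
    | exact absurd h Bool.false_ne_true
    | assumption

theorem toA_surjective : Function.Surjective toA := by
  intro x
  let m : Matrix (Fin 3) (Fin 3) ℚ := x 0 0
  let u : Matrix (Fin 3) (Fin 1) ℚ := x 0 3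
  let v : Matrix (Fin 1) (Fin 3) ℚ := x 3 0
  let p : LocAlg := x 3 3
  refine ⟨![m 0 0, m 0 1, m 0 2, m 1 0, m 1 1, m 1 2, m 2 0, m 2 1, m 2 2, u 0 0, u 1 0, u 2 0,
    (x 1 1 : ℚ), (x 1 3 : ℚ), (x 2 2 : ℚ), v 0 0, v 0 1, v 0 2, (x 3 1 : ℚ),
    coeffOne p, coeffEta p, coeffXi p], A_ext ?_ ?_ rfl rfl rfl ?_ rfl (eq_coeffs p).symm⟩
  · exact (Matrix.eta_fin_three m).symm
  · change !![u 0 0; u 1 0; u 2 0] = u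
    ext i j
    fin_cases i <;> fin_cases j <;> rfl
  · change !![v 0 0, v 0 1, v 0 2] = v
    ext i j
    fin_cases i <;> fin_cases j <;> rfl

set_option maxHeartbeats 1000000 in
theorem toA_mul_toA (v w : Fin 22 → ℚ) : toA v * toA w = toA (mulA v w) := by
  refine A_ext ?_ ?_ ?_ ?_ ?_ ?_ ?_ ?_ <;> rw [A.mul_apply, Fin.sum_univ_four]
  · suffices h : (!![v 0, v 1, v 2; v 3, v 4, v 5; v 6, v 7, v 8] *
      !![w 0, w 1, w 2; w 3, w 4, w 5; w 6, w 7, w 8] + 0 + 0 + 0 : Matrix (Fin 3) (Fin 3) ℚ) =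
      !![mulA v w 0, mulA v w 1, mulA v w 2; mulA v w 3, mulA v w 4, mulA v w 5;
        mulA v w 6, mulA v w 7, mulA v w 8] from h
    ext i j
    fin_cases i <;> fin_cases j <;> simp [mulA, mulTerms]
  · suffices h : (!![v 0, v 1, v 2; v 3, v 4, v 5; v 6, v 7, v 8] * !![w 9; w 10; w 11] + 0 + 0 +
      coeffOne (w 19 • 1 + w 20 • eta + w 21 • xi) • !![v 9; v 10; v 11] :
      Matrix (Fin 3) (Fin 1) ℚ) = !![mulA v w 9; mulA v w 10; mulA v w 11] from h
    rw [(coeff_apply _ _ _).1]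
    ext i j
    fin_cases i <;> fin_cases j <;>
      simp [mulA, mulTerms, add_assoc, mul_comm (w 19)]
  · suffices h : (0 + v 12 * w 12 + 0 + 0 : ℚ) = mulA v w 12 from h
    simp [mulA, mulTerms]
  · suffices h : (0 + v 12 * w 13 + 0 + coeffOne (w 19 • 1 + w 20 • eta + w 21 • xi) * v 13 : ℚ) =
      mulA v w 13 from h
    rw [(coeff_apply _ _ _).1]
    simp [mulA, mulTerms, mul_comm (w 19)]
  · suffices h : (0 + 0 + v 14 * w 14 + 0 : ℚ) = mulA v w 14 from h
    simp [mulA, mulTerms]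
  · suffices h : (!![v 15, v 16, v 17] * !![w 0, w 1, w 2; w 3, w 4, w 5; w 6, w 7, w 8] + 0 + 0 +
      coeffOne (v 19 • 1 + v 20 • eta + v 21 • xi) • !![w 15, w 16, w 17] :
      Matrix (Fin 1) (Fin 3) ℚ) = !![mulA v w 15, mulA v w 16, mulA v w 17] from h
    rw [(coeff_apply _ _ _).1]
    ext i j
    fin_cases i <;> fin_cases j <;> simp [mulA, mulTerms, add_assoc]
  · suffices h : (0 + v 18 * w 12 + 0 + coeffOne (v 19 • 1 + v 20 • eta + v 21 • xi) * w 18 : ℚ) =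
      mulA v w 18 from h
    rw [(coeff_apply _ _ _).1]
    simp [mulA, mulTerms]
  -- The block map into `ξ - 12 η` feeds the product `v 18 * w 13` into both nilpotent coordinates,
  -- which is the origin of the coefficient `-12` in `mulTerms`.
  · suffices h : ((!![v 15, v 16, v 17] * !![w 9; w 10; w 11] : Matrix (Fin 1) (Fin 1) ℚ) 0 0 • eta +
      (v 18 * w 13) • (xi - (12 : ℚ) • eta) + 0 +
      (v 19 • 1 + v 20 • eta + v 21 • xi) * (w 19 • 1 + w 20 • eta + w 21 • xi) : LocAlg) =
      mulA v w 19 • 1 + mulA v w 20 • eta + mulA v w 21 • xi from h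
    simp [mulA, mulTerms, Matrix.mul_apply, Fin.sum_univ_three, add_mul, mul_add, eta_mul_eta,
      eta_mul_xi, xi_mul_xi, mul_comm xi eta]
    module

/-- The linear map `[a_{i,j}] ↦ ∑ γ_{i,j}(a_{i,j})`. -/
def gammaLin : A →ₗ[ℚ] BQ where
  toFun x := ∑ i, ∑ j, gammaBlk i j (x i j)
  map_add' x y := by
    simp only [A.add_apply, map_add, Finset.sum_add_distrib]
  map_smul' c x := by
    simp only [A.smul_apply, map_smul, Finset.smul_sum, RingHom.id_apply]

set_option maxHeartbeats 1000000 in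
theorem gammaLin_toA (v : Fin 22 → ℚ) : gammaLin (toA v) = gammaCoord v := by
  change ∑ i, ∑ j, gammaBlk i j (toA v i j) = _
  have h₀ : ∀ i j, edge i j ≠ true → gammaBlk i j (toA v i j) = 0 := fun i j h => by
    rw [blk_eq_zero i j h (toA v i j), map_zero]
  have h₀₀ : gammaBlk 0 0 (toA v 0 0) = v 0 • gb 0 + v 1 • gb 1 + v 2 • gb 2 + v 3 • gb 3 +
      v 4 • gb 4 + v 5 • gb 5 + v 6 • gb 6 + v 7 • gb 7 + v 8 • gb 8 := by
    change matComb _ !![v 0, v 1, v 2; v 3, v 4, v 5; v 6, v 7, v 8] = _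
    simp [matComb, Fin.sum_univ_three, gb, add_assoc]
  have h₀₃ : gammaBlk 0 3 (toA v 0 3) = v 9 • gb 9 + v 10 • gb 10 + v 11 • gb 11 := by
    change matComb _ !![v 9; v 10; v 11] = _
    simp [matComb, Fin.sum_univ_three, gb]
  have h₃₀ : gammaBlk 3 0 (toA v 3 0) = v 15 • gb 15 + v 16 • gb 16 + v 17 • gb 17 := by
    change matComb _ !![v 15, v 16, v 17] = _
    simp [matComb, Fin.sum_univ_three, gb]
  have h₁₁ : gammaBlk 1 1 (toA v 1 1) = v 12 • gb 12 := rfl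
  have h₁₃ : gammaBlk 1 3 (toA v 1 3) = v 13 • gb 13 := rfl
  have h₂₂ : gammaBlk 2 2 (toA v 2 2) = v 14 • gb 14 := rfl
  have h₃₁ : gammaBlk 3 1 (toA v 3 1) = v 18 • gb 18 := rfl
  have h₃₃ : gammaBlk 3 3 (toA v 3 3) = v 19 • gb 19 + v 20 • gb 20 + v 21 • gb 21 := by
    change coeffOne (v 19 • 1 + v 20 • eta + v 21 • xi) • idem4 +
      coeffEta (v 19 • 1 + v 20 • eta + v 21 • xi) • b_4_4 +
      coeffXi (v 19 • 1 + v 20 • eta + v 21 • xi) • c_4_4 = _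
    rw [(coeff_apply _ _ _).1, (coeff_apply _ _ _).2.1, (coeff_apply _ _ _).2.2]
    rfl
  rw [gammaCoord, Fintype.linearCombination_apply]
  simp only [Fin.sum_univ_four, h₀₀, h₀₃, h₁₁, h₁₃, h₂₂, h₃₀, h₃₁, h₃₃,
    h₀ 0 1 Bool.false_ne_true, h₀ 0 2 Bool.false_ne_true, h₀ 1 0 Bool.false_ne_true,
    h₀ 1 2 Bool.false_ne_true, h₀ 2 0 Bool.false_ne_true, h₀ 2 1 Bool.false_ne_true,
    h₀ 2 3 Bool.false_ne_true, h₀ 3 2 Bool.false_ne_true, zero_add, add_zero]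
  simp only [Fin.sum_univ_succ, Fin.sum_univ_zero]
  simp only [add_zero, add_assoc]
  rfl

/-! ### The isomorphism of algebras -/

/-- `S₃` is a transitive biset, and the stabilizer of its identity element is the full diagonal. -/
theorem HΔ5_eq_one : HΔ5 = 1 := by
  rw [← Burnside.of_regular ℚ, HΔ5, H]
  have h : diag V5 = (Biset.regular S3).stab (1 : S3) := by
    ext ⟨g, h⟩
    constructor
    · rintro ⟨x, -, hx⟩
      obtain ⟨rfl, rfl⟩ := Prod.mk_inj.1 hx
      change x * (1 * x⁻¹) = 1
      group
    · intro hp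
      change g * (1 * h⁻¹) = 1 at hp
      rw [one_mul, mul_inv_eq_one] at hp
      exact ⟨g, Subgroup.mem_top g, Prod.ext rfl hp⟩
  rw [h]
  exact Burnside.of_iso ℚ (Biset.iso_of_transitive _ _ fun (n : S3) =>
    ⟨(n, 1), show n * (1 * 1⁻¹) = n by group⟩)

theorem eps_eq_gammaBlk (i : Fin 4) : eps i = gammaBlk i i (oneBlk i i) := by
  fin_cases i
  · change idemE + idemG + idemH = matComb _ (1 : Matrix (Fin 3) (Fin 3) ℚ)
    simp [matComb, Fin.sum_univ_three]
  · exact (one_smul ℚ idem2).symm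
  · exact (one_smul ℚ idem3).symm
  · change idem4 = coeffOne 1 • idem4 + coeffEta 1 • b_4_4 + coeffXi 1 • c_4_4
    have h := coeff_apply 1 0 0
    simp only [one_smul, zero_smul, add_zero] at h
    rw [h.1, h.2.1, h.2.2, one_smul, zero_smul, zero_smul, add_zero, add_zero]

/-- Every other basis element cancels in the sum of the idempotents, leaving only `HΔ5`. -/
theorem sum_eps : ∑ i, eps i = 1 := by
  rw [← HΔ5_eq_one, Fin.sum_univ_four]
  change idemE + idemG + idemH + idem2 + idem3 + idem4 = HΔ5
  unfold idemE idemG idemH idem2 idem3 idem4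
  module

theorem gammaLin_one : gammaLin 1 = 1 := by
  change ∑ i, ∑ j, gammaBlk i j (oneBlk i j) = 1
  rw [← sum_eps]
  refine Finset.sum_congr rfl fun i _ => ?_
  rw [eps_eq_gammaBlk, Finset.sum_eq_single i]
  · exact fun j _ hj => by rw [oneBlk_ne i j hj.symm, map_zero]
  · exact fun h => absurd (Finset.mem_univ i) h

/-- The elements of `B_ℚ(S₃, S₃)` on which left multiplication corresponds under `γ` to a left
multiplication of `A`. -/
def liftable : Subalgebra ℚ BQ where
  carrier := {x | ∃ c, gammaLin c = x ∧ ∀ d, gammaLin (c * d) = x * gammaLin d}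
  mul_mem' := by
    rintro _ _ ⟨c, rfl, hc⟩ ⟨d, rfl, hd⟩
    exact ⟨c * d, hc d, fun f => by rw [mul_assoc, hc, hd, mul_assoc]⟩
  add_mem' := by
    rintro _ _ ⟨c, rfl, hc⟩ ⟨d, rfl, hd⟩
    exact ⟨c + d, map_add _ _ _, fun f => by rw [add_mul, map_add, hc, hd, add_mul]⟩
  algebraMap_mem' r := ⟨r • 1, by rw [map_smul, gammaLin_one, Algebra.algebraMap_eq_smul_one],
    fun d => by rw [smul_mul_assoc, one_mul, map_smul, Algebra.smul_def]⟩

theorem hb_mem_liftable {s : ℕ} (hs : s ∈ [15, 16, 17, 20]) : hb s ∈ liftable := by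
  have H : ∀ d, gammaLin (toA (fun k => (sigmaRow s k : ℚ) / 6) * d) = hb s * gammaLin d := by
    intro d
    obtain ⟨w, rfl⟩ := toA_surjective d
    rw [toA_mul_toA, gammaLin_toA, gammaLin_toA, hb_mul_gammaCoord hs]
  refine ⟨toA fun k => (sigmaRow s k : ℚ) / 6, ?_, H⟩
  -- Taking `d = 1` shows that the chosen element of `A` maps to `hb s`; the entries of `sigmaRow`
  -- therefore need no verification beyond `mulRow_check`.
  have h := H 1
  rwa [mul_one, gammaLin_one, mul_one] at h

/-- `B_ℚ(S₃, S₃)` is generated by the classes of `S₃ × S₃`, `U₆`, `U₇` and `Δ(V₄)`. -/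
theorem eq_top_of_hb_mem {S : Subalgebra ℚ BQ} (h₁₅ : hb 15 ∈ S) (h₁₆ : hb 16 ∈ S)
    (h₁₇ : hb 17 ∈ S) (h₂₀ : hb 20 ∈ S) : S = ⊤ := by
  have hmul : ∀ s i k, s ∈ [15, 16, 17, 20] → i < 22 → mulRow s i = unitL k → hb s ∈ S →
      hb i ∈ S → hb k ∈ S := fun s i k hs hi h hsS hiS => by
    rw [← evalL_unitL hb k, ← h, ← hb_mul_hb_mulRow hs hi]
    exact mul_mem hsS hiS
  -- All but two of the remaining basis elements arise as products consisting of a single orbit,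
  -- with one of the four generators on the left and an element already obtained on the right.
  have h₁₉ := hmul 16 17 19 (by decide) (by decide) (by decide) h₁₆ h₁₇
  have h₀ := hmul 20 19 0 (by decide) (by decide) (by decide) h₂₀ h₁₉
  have h₁₂ := hmul 15 0 12 (by decide) (by decide) (by decide) h₁₅ h₀
  have h₁₃ := hmul 15 17 13 (by decide) (by decide) (by decide) h₁₅ h₁₇
  have h₁₄ := hmul 15 20 14 (by decide) (by decide) (by decide) h₁₅ h₂₀
  have h₄ := hmul 16 12 4 (by decide) (by decide) (by decide) h₁₆ h₁₂
  have h₅ := hmul 16 13 5 (by decide) (by decide) (by decide) h₁₆ h₁₃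
  have h₆ := hmul 16 14 6 (by decide) (by decide) (by decide) h₁₆ h₁₄
  have h₇ := hmul 16 15 7 (by decide) (by decide) (by decide) h₁₆ h₁₅
  have h₈ := hmul 20 12 8 (by decide) (by decide) (by decide) h₂₀ h₁₂
  have h₉ := hmul 20 13 9 (by decide) (by decide) (by decide) h₂₀ h₁₃
  have h₁₀ := hmul 20 14 10 (by decide) (by decide) (by decide) h₂₀ h₁₄
  have h₁₁ := hmul 20 15 11 (by decide) (by decide) (by decide) h₂₀ h₁₅
  have h₁ := hmul 20 5 1 (by decide) (by decide) (by decide) h₂₀ h₅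
  have h₂ := hmul 20 6 2 (by decide) (by decide) (by decide) h₂₀ h₆
  have h₃ := hmul 20 7 3 (by decide) (by decide) (by decide) h₂₀ h₇
  -- The class of `U₈` is obtained from a product with two orbits, the other of which is already
  -- known to lie in `S`.
  have h₁₈ : hb 18 ∈ S := by
    have h : hb 17 * hb 16 = hb 10 + hb 18 := by
      rw [hb_mul_hb_mulRow (by decide) (by decide),
        (by decide : mulRow 17 16 = addL (unitL 10) (unitL 18)), evalL_addL, evalL_unitL,
        evalL_unitL]
    rw [← add_sub_cancel_left (hb 10) (hb 18), ← h]
    exact sub_mem (mul_mem h₁₇ h₁₆) h₁₀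
  have h₂₁ : hb 21 ∈ S := by
    change HΔ5 ∈ S
    rw [HΔ5_eq_one]
    exact one_mem S
  rw [← Algebra.toSubmodule_eq_top, eq_top_iff, ← span_hb, Submodule.span_le]
  rintro _ ⟨⟨k, hk⟩, rfl⟩
  change hb k ∈ S
  interval_cases k <;> assumption

theorem liftable_eq_top : liftable = ⊤ :=
  eq_top_of_hb_mem (hb_mem_liftable (by decide)) (hb_mem_liftable (by decide))
    (hb_mem_liftable (by decide)) (hb_mem_liftable (by decide))

theorem gammaLin_surjective : Function.Surjective gammaLin := fun x => by
  obtain ⟨c, hc, -⟩ : x ∈ liftable := liftable_eq_top ▸ Algebra.mem_top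
  exact ⟨c, hc⟩

/-- In coordinates `γ` is a surjection between spaces of dimension 22. The independence of the `hb
k` enters the argument only here, through the dimension of `B`. -/
theorem gammaLin_injective : Function.Injective gammaLin := by
  have hbasis := Module.finrank_eq_card_basis (Module.Basis.mk linearIndependent_hb span_hb.ge)
  have : FiniteDimensional ℚ BQ :=
    (Module.Basis.mk linearIndependent_hb span_hb.ge).finiteDimensional_of_finite
  have hinj : Function.Injective gammaCoord := by
    refine (LinearMap.injective_iff_surjective_of_finrank_eq_finrank ?_).2 fun x => ?_
    · rw [hbasis, Module.finrank_fin_fun, Fintype.card_fin]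
    · obtain ⟨c, rfl⟩ := gammaLin_surjective x
      obtain ⟨v, rfl⟩ := toA_surjective c
      exact ⟨v, (gammaLin_toA v).symm⟩
  intro c d h
  obtain ⟨v, rfl⟩ := toA_surjective c
  obtain ⟨w, rfl⟩ := toA_surjective d
  rw [gammaLin_toA, gammaLin_toA] at h
  rw [hinj h]

/-- The element `γ(c)` is liftable through some `c'` with `γ(c') = γ(c)`, and injectivity forces `c'
= c`. -/
theorem gammaLin_mul (c d : A) : gammaLin (c * d) = gammaLin c * gammaLin d := by
  obtain ⟨c', hc, h⟩ : gammaLin c ∈ liftable := liftable_eq_top ▸ Algebra.mem_top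
  obtain rfl := gammaLin_injective hc
  exact h d

/-- The isomorphism of algebras `γ`. -/
def gamma : A ≃ₐ[ℚ] BQ :=
  AlgEquiv.ofBijective (AlgHom.ofLinearMap gammaLin gammaLin_one gammaLin_mul)
    ⟨gammaLin_injective, gammaLin_surjective⟩

/-! ### The Peirce components -/

/-- The element of `A` with the given `(i, j)` block and all other blocks zero. -/
def single (i j : Fin 4) (x : Blk i j) : A := Pi.single i (Pi.single j x : ∀ l, Blk i l)

theorem single_apply_self (i j : Fin 4) (x : Blk i j) : single i j x i j = x := by
  rw [single, Pi.single_eq_same, Pi.single_eq_same]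

theorem single_apply_of_ne_left {i k : Fin 4} (h : k ≠ i) (j l : Fin 4) (x : Blk i j) :
    single i j x k l = 0 := by
  rw [single, Pi.single_eq_of_ne h]
  rfl

theorem single_apply_of_ne_right {j l : Fin 4} (h : l ≠ j) (i k : Fin 4) (x : Blk i j) :
    single i j x k l = 0 := by
  by_cases hk : k = i
  · subst hk
    rw [single, Pi.single_eq_same, Pi.single_eq_of_ne h]
  · exact single_apply_of_ne_left hk j l x

theorem gammaLin_single (i j : Fin 4) (x : Blk i j) :
    gammaLin (single i j x) = gammaBlk i j x := by
  change ∑ k, ∑ l, gammaBlk k l (single i j x k l) = _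
  rw [Finset.sum_eq_single i, Finset.sum_eq_single j, single_apply_self]
  · exact fun l _ hl => by rw [single_apply_of_ne_right hl, map_zero]
  · exact fun h => absurd (Finset.mem_univ j) h
  · exact fun k _ hk => Finset.sum_eq_zero fun l _ => by
      rw [single_apply_of_ne_left hk, map_zero]
  · exact fun h => absurd (Finset.mem_univ i) h

theorem single_mul_single (i j k : Fin 4) (x : Blk i j) (y : Blk j k) :
    single i j x * single j k y = single i k (alpha i j k x y) := by
  funext s t
  rw [A.mul_apply, Finset.sum_eq_single j]
  · by_cases hs : s = i
    · subst hs
      by_cases ht : t = k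
      · subst ht
        rw [single_apply_self, single_apply_self, single_apply_self]
      · rw [single_apply_of_ne_right ht, single_apply_of_ne_right ht, map_zero]
    · rw [single_apply_of_ne_left hs, single_apply_of_ne_left hs, map_zero, LinearMap.zero_apply]
  · exact fun r _ hr => by rw [single_apply_of_ne_left hr k t y, map_zero]
  · exact fun h => absurd (Finset.mem_univ j) h

theorem single_mul_single_of_ne {j k : Fin 4} (h : j ≠ k) (i l : Fin 4) (x : Blk i j)
    (y : Blk k l) : single i j x * single k l y = 0 := by
  funext s t
  rw [A.mul_apply, A.zero_apply]
  refine Finset.sum_eq_zero fun r _ => ?_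
  by_cases hr : r = j
  · subst hr
    rw [single_apply_of_ne_left h, map_zero]
  · rw [single_apply_of_ne_right hr, map_zero, LinearMap.zero_apply]

/-- Multiplicativity of `γ` applied to two elements supported in one block each. -/
theorem gammaBlk_mul_gammaBlk (i j k : Fin 4) (x : Blk i j) (y : Blk j k) :
    gammaBlk i j x * gammaBlk j k y = gammaBlk i k (alpha i j k x y) := by
  rw [← gammaLin_single, ← gammaLin_single, ← gammaLin_mul, single_mul_single, gammaLin_single]

theorem gammaBlk_mul_gammaBlk_of_ne {j k : Fin 4} (h : j ≠ k) (i l : Fin 4) (x : Blk i j)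
    (y : Blk k l) : gammaBlk i j x * gammaBlk k l y = 0 := by
  rw [← gammaLin_single, ← gammaLin_single, ← gammaLin_mul, single_mul_single_of_ne h, map_zero]

theorem gammaBlk_injective (i j : Fin 4) : Function.Injective (gammaBlk i j) := fun x y h => by
  rw [← gammaLin_single, ← gammaLin_single] at h
  rw [← single_apply_self i j x, gammaLin_injective h, single_apply_self]

/-- As `ε_i` is the image of the `i`-th diagonal identity, multiplying `γ(c)` by `ε_i` on the left
and `ε_j` on the right removes all blocks except `c i j`. Every element of `B` is of the form
`γ(c)`, so this describes the whole Peirce component. -/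
theorem range_gammaBlk (i j : Fin 4) : LinearMap.range (gammaBlk i j) = peirce i j := by
  refine le_antisymm ?_ ?_
  · rintro _ ⟨x, rfl⟩
    refine ⟨gammaBlk i j x, ?_⟩
    change eps i * (gammaBlk i j x * eps j) = _
    rw [eps_eq_gammaBlk, eps_eq_gammaBlk, gammaBlk_mul_gammaBlk, alpha_one_right,
      gammaBlk_mul_gammaBlk, alpha_one_left]
  · rintro _ ⟨z, rfl⟩
    obtain ⟨c, rfl⟩ := gammaLin_surjective z
    refine ⟨c i j, ?_⟩
    change gammaBlk i j (c i j) = eps i * ((∑ k, ∑ l, gammaBlk k l (c k l)) * eps j)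
    rw [eps_eq_gammaBlk, eps_eq_gammaBlk, Finset.sum_mul, Finset.mul_sum, Finset.sum_eq_single i,
      Finset.sum_mul, Finset.mul_sum, Finset.sum_eq_single j, gammaBlk_mul_gammaBlk,
      alpha_one_right, gammaBlk_mul_gammaBlk, alpha_one_left]
    · exact fun l _ hl => by rw [gammaBlk_mul_gammaBlk_of_ne hl, mul_zero]
    · exact fun h => absurd (Finset.mem_univ j) h
    · intro k _ hk
      rw [← mul_assoc, Finset.mul_sum, Finset.sum_eq_zero, zero_mul]
      exact fun l _ => gammaBlk_mul_gammaBlk_of_ne hk.symm _ _ _ _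
    · exact fun h => absurd (Finset.mem_univ i) h

end DoubleBurnside

end

theorem proposition4p3 :
    (∀ i j : Fin 4, Function.Injective (DoubleBurnside.gammaBlk i j) ∧
      LinearMap.range (DoubleBurnside.gammaBlk i j) = DoubleBurnside.peirce i j) ∧
    (∀ (i j k : Fin 4) (x : DoubleBurnside.Blk i j) (y : DoubleBurnside.Blk j k),
      DoubleBurnside.gammaBlk i k (DoubleBurnside.alpha i j k x y) =
        DoubleBurnside.gammaBlk i j x * DoubleBurnside.gammaBlk j k y) ∧
    ∃ γ : DoubleBurnside.A ≃ₐ[ℚ] DoubleBurnside.BQ,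
      ∀ x : DoubleBurnside.A, γ x = ∑ i, ∑ j, DoubleBurnside.gammaBlk i j (x i j) :=
  ⟨fun i j => ⟨DoubleBurnside.gammaBlk_injective i j, DoubleBurnside.range_gammaBlk i j⟩,
    fun i j k x y => (DoubleBurnside.gammaBlk_mul_gammaBlk i j k x y).symm,
    DoubleBurnside.gamma, fun _ => rfl⟩
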